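/- Let $F=\mathbb{Q}(t)$ and let $V$ be the ring of symmetric functions over $F$ in $x_1,x_2,\dots$. Write $p_k=\sum_i x_i^k$ and $p_\mu=p_{\mu_1}p_{\mu_2}\cdots$. For a partition $\lambda$ with multiplicities $m_i=m_i(\lambda)$ put $z_\lambda(t)=\prod_i i^{m_i}m_i!\,/\prod_i(1-t^{\lambda_i})$ and $b_\lambda(t)=\prod_i\prod_{k=1}^{m_i}(1-t^k)$. Put $q_n=\sum_{\lambda\vdash n}z_\lambda(t)^{-1}p_\lambda$ for $n\ge 0$ and $q_n=0$ for $n<0$. The Hall–Littlewood functions are $$Q_\lambda(t)=\prod_{1\le i<j\le l(\lambda)}\frac{1-R_{ij}}{1-tR_{ij}}\;q_{\lambda_1}\cdots q_{\lambda_{l(\lambda)}},\qquad P_\lambda(t)=b_\lambda(t)^{-1}Q_\lambda(t),$$ where the raising operator $R_{ij}$ adds $1$ to the $i$-th index and subtracts $1$ from the $j$-th index. Each $p_\mu$, $\mu\vdash n$, has a unique expansion $p_\mu=\sum_{\lambda\vdash n}X^\lambda_\mu(t)P_\lambda(t)$ with coefficients in $F$; these coefficients $X^\lambda_\mu(t)$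 are the Green polynomials. Let $\alpha=(\alpha_1,\dots,\alpha_l)$ be a sequence of integers. If $\alpha_i<\alpha_{i+1}$, put $d=\alpha_{i+1}-\alpha_i$. For integers $0\le a\le\lfloor d/2\rfloor$ let $S_{i,a}$ replace $(\alpha_i,\alpha_{i+1})$ by $(\alpha_{i+1}-a,\alpha_i+a)$, and let $$C(S_{i,a})=\begin{cases}t & a=0,\\ t^{a+1}-t^{a-1} & 1\le a<\lfloor d/2\rfloor,\\ t^{a+\epsilon}-t^{a-1} & 1\le a=\lfloor d/2\rfloor,\end{cases}$$ where $\epsilon\in\{0,1\}$ is the parity of $d$. Fix any straightening rule $\sigma$: for every integer sequence $\alpha$ that is not weakly decreasing it selects an index $i=\sigma(\alpha)$ with $\alpha_i<\alpha_{i+1}$ (for example the leftmost one). A straightening sequence for $\alpha$ is a pair $\underline i=(i_1,\dots,i_r)$, $\underline a=(a_1,\dots,a_r)$ with $r\ge 0$ such that $S_{i_1,a_1}\cdots S_{i_r,a_r}\alpha$, computed from right to left, is defined and each $S_{i_k,a_k}$ acts at the index selected by $\sigma$ for the sequence it is applied to. Put $C(S_{\underline i,\underline a})=\prod_k C(S_{i_k,a_k})$,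 each factor taken for the sequence on which $S_{i_k,a_k}$ acts. **Theorem.** Let $n\ge1$, let $\lambda,\mu\vdash n$, let $\mu^{[1]}=(\mu_2,\mu_3,\dots)$, and let $\varepsilon_j$ be the $j$-th unit vector of length $l(\lambda)$. Then, for every straightening rule, $$X^\lambda_\mu(t)=\sum_{j=1}^{l(\lambda)}\ \sum_{\underline i,\underline a}C(S_{\underline i,\underline a})\,X^{S_{i_1,a_1}\cdots S_{i_r,a_r}(\lambda-\mu_1\varepsilon_j)}_{\mu^{[1]}}(t),$$ where for each $j$ the inner sum is over the finitely many straightening sequences $(\underline i,\underline a)$ for $\lambda-\mu_1\varepsilon_j$ such that $S_{i_1,a_1}\cdots S_{i_r,a_r}(\lambda-\mu_1\varepsilon_j)$ is a partition of $n-\mu_1$ (weakly decreasing with nonnegative entries, zeros at the end being ignored). -/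

import Mathlib

noncomputable section

namespace GreenMN

/-! ### Symmetric functions in the variables `x₀, x₁, x₂, …` over `F = ℚ(t)` -/

/-- The field `F = ℚ(t)` of rational functions. -/
abbrev F : Type := RatFunc ℚ

/-- The variable `t`. -/
def t : F := RatFunc.X

/-- Formal power series in `x₀, x₁, …` over `F`; the symmetric functions used below are the
elements of this ring built from the power sums. -/
abbrev V : Type := MvPowerSeries ℕ F

open Classical in
/-- The power sum `p_k = ∑_i x_i ^ k` (`k ≥ 1`): the coefficient of a monomial is `1` if the
monomial is `x_i ^ k` for some `i`, and `0` otherwise. -/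
def powerSum (k : ℕ) : V := fun m : ℕ →₀ ℕ => if ∃ i, m = Finsupp.single i k then 1 else 0

/-- `p_μ = p_{μ₁} p_{μ₂} ⋯`. -/
def powerSumP {n : ℕ} (mu : n.Partition) : V := (mu.parts.map powerSum).prod

/-- `z_λ(t) = ∏_i i^{m_i} m_i! / ∏_i (1 - t^{λ_i})`. -/
def zt {n : ℕ} (lam : n.Partition) : F :=
  (∏ i ∈ lam.parts.toFinset,
      (i : F) ^ lam.parts.count i * ((lam.parts.count i).factorial : F)) /
    (lam.parts.map fun i => 1 - t ^ i).prod

/-- `q_n = ∑_{λ ⊢ n} z_λ(t)⁻¹ p_λ`, the coefficient of `z^n` in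
`exp (∑_{k ≥ 1} (1 - t^k) / k * p_k z^k)`. -/
def q (n : ℕ) : V := ∑ lam : n.Partition, (zt lam)⁻¹ • powerSumP lam

/-- `q_k` for an integer `k`, with `q_k = 0` for `k < 0`. -/
def qInt (k : ℤ) : V := if k < 0 then 0 else q k.toNat

/-- The parts of a partition, in weakly decreasing order. -/
def rows {n : ℕ} (lam : n.Partition) : List ℕ := lam.parts.sort (· ≥ ·)

/-- The coefficient of `R ^ m` in `(1 - R) / (1 - t R)`. -/
def raiseCoeff : ℕ → F
  | 0 => 1
  | m + 1 => t ^ (m + 1) - t ^ m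

/-- The Hall–Littlewood function
`Q_λ(t) = ∏_{i < j} (1 - R_{ij}) / (1 - t R_{ij}) q_{λ₁} ⋯ q_{λ_l}`, where the raising operator
`R_{ij}` adds `1` to the `i`-th index and subtracts `1` from the `j`-th. Here `M e` is the exponent
of `R_e` for `e = (i, j)`. Only the finitely many `M` with `M (i, j) ≤ λ_j + ⋯ + λ_l` contribute,
since for any other `M` some index is negative. -/
def hlQ {n : ℕ} (lam : n.Partition) : V :=
  ∑ᶠ M : {e : Fin (rows lam).length × Fin (rows lam).length // e.1 < e.2} → ℕ,
    (∏ e, raiseCoeff (M e)) •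
      ∏ i : Fin (rows lam).length,
        qInt (((rows lam).get i : ℤ) + (∑ e with e.1.1 = i, (M e : ℤ))
          - (∑ e with e.1.2 = i, (M e : ℤ)))

/-- `b_λ(t) = ∏_i (1 - t) (1 - t²) ⋯ (1 - t^{m_i(λ)})`. -/
def b {n : ℕ} (lam : n.Partition) : F :=
  ∏ i ∈ lam.parts.toFinset, ∏ k ∈ Finset.Icc 1 (lam.parts.count i), (1 - t ^ k)

/-- `P_λ(t) = b_λ(t)⁻¹ Q_λ(t)`. -/
def hlP {n : ℕ} (lam : n.Partition) : V := (b lam)⁻¹ • hlQ lam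

/-- `c` is a family of coefficients of `p_μ` with respect to the `P_λ`:
`p_μ = ∑_λ c_λ P_λ(t)`. -/
def IsExpansion {n : ℕ} (mu : n.Partition) (c : n.Partition → F) : Prop :=
  powerSumP mu = ∑ lam : n.Partition, c lam • hlP lam

/-- The Green polynomial `X^λ_μ(t)`: the coefficient of `P_λ(t)` in `p_μ`. -/
def green {n : ℕ} (lam mu : n.Partition) : F := Classical.epsilon (IsExpansion mu) lam

/-! ### Straightening of integer sequences -/

/-- `α_i < α_{i+1}` (positions are counted from `0`). -/
def IsAscent (α : List ℤ) (i : ℕ) : Prop :=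
  i + 1 < α.length ∧ α.getD i 0 < α.getD (i + 1) 0

/-- `S_{i,a}` replaces `(α_i, α_{i+1})` by `(α_{i+1} - a, α_i + a)`. -/
def S (i a : ℕ) (α : List ℤ) : List ℤ :=
  (α.set i (α.getD (i + 1) 0 - a)).set (i + 1) (α.getD i 0 + a)

/-- `α_{i+1} - α_i`. -/
def gap (α : List ℤ) (i : ℕ) : ℤ := α.getD (i + 1) 0 - α.getD i 0

/-- The coefficient `C(S_{i,a})` of the transformation `S_{i,a}` of `α`. -/
def C (i a : ℕ) (α : List ℤ) : F :=
  if a = 0 then t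
  else if (a : ℤ) < gap α i / 2 then t ^ (a + 1) - t ^ (a - 1)
  else t ^ (a + (gap α i % 2).toNat) - t ^ (a - 1)

/-- `S_{i₁,a₁} S_{i₂,a₂} ⋯ S_{i_r,a_r} α`, acting from right to left. -/
def applySeq : List (ℕ × ℕ) → List ℤ → List ℤ
  | [], α => α
  | (i, a) :: s, α => S i a (applySeq s α)

/-- `C(S_{i₁,a₁}) ⋯ C(S_{i_r,a_r})`, each factor taken at the sequence on which the corresponding
transformation acts. -/
def seqC : List (ℕ × ℕ) → List ℤ → F
  | [], _ => 1
  | (i, a) :: s, α => C i a (applySeq s α) * seqC s α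

/-- A straightening rule selects an ascent of every integer sequence that has one. -/
def IsRule (σ : List ℤ → ℕ) : Prop := ∀ α, (∃ i, IsAscent α i) → IsAscent α (σ α)

/-- `S_{i₁,a₁} ⋯ S_{i_r,a_r} α` is defined, and each step acts at the ascent selected by `σ`. -/
def IsStraightening (σ : List ℤ → ℕ) : List (ℕ × ℕ) → List ℤ → Prop
  | [], _ => True
  | (i, a) :: s, α => IsStraightening σ s α ∧
      IsAscent (applySeq s α) i ∧ i = σ (applySeq s α) ∧ (a : ℤ) ≤ gap (applySeq s α) i / 2

/-- `α` is a partition of `m`, possibly with zeros at the end. -/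
def IsPart (m : ℕ) (α : List ℤ) : Prop :=
  α.Pairwise (· ≥ ·) ∧ (∀ x ∈ α, 0 ≤ x) ∧ α.sum = m

/-- The sequences `(i, a)` following `σ` that turn `α` into a partition of `m`. -/
def straighteningSeqs (σ : List ℤ → ℕ) (m : ℕ) (α : List ℤ) : Set (List (ℕ × ℕ)) :=
  {s | IsStraightening σ s α ∧ IsPart m (applySeq s α)}

/-- `X^α_ν(t)` for a sequence `α` that is a partition of `m` up to zeros at the end (`IsPart m α`);
it is only used for such `α`. -/
def greenSeq {m : ℕ} (α : List ℤ) (nu : m.Partition) : F :=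
  if h : (Multiset.ofList (α.map Int.toNat)).sum = m then
    green (Nat.Partition.ofSums m (Multiset.ofList (α.map Int.toNat)) h) nu
  else 0

/-! ### Removing the first part -/

/-- `μ₁`, the largest part (`0` for the empty partition). -/
def firstPart {n : ℕ} (mu : n.Partition) : ℕ := (rows mu).headD 0

theorem firstPart_add_sum {n : ℕ} (mu : n.Partition) :
    firstPart mu + (mu.parts.erase (firstPart mu)).sum = n := by
  have hs : (rows mu : Multiset ℕ) = mu.parts := Multiset.sort_eq _ _
  have hsum := mu.parts_sum
  unfold firstPart
  rw [← hs] at hsum ⊢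
  cases h : rows mu with
  | nil => simpa [h] using hsum
  | cons a l => simpa [h] using hsum

/-- `μ^{[1]} = (μ₂, μ₃, …)`. -/
def tail {n : ℕ} (mu : n.Partition) : (n - firstPart mu).Partition where
  parts := mu.parts.erase (firstPart mu)
  parts_pos hi := mu.parts_pos (Multiset.mem_of_mem_erase hi)
  parts_sum := by
    have := firstPart_add_sum mu
    omega

/-- `λ - k ε_j`, a sequence of length `l(λ)` (positions are counted from `0`). -/
def subAt {n : ℕ} (lam : n.Partition) (k j : ℕ) : List ℤ :=
  ((rows lam).map fun x => (x : ℤ)).modify j fun x => x - k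

end GreenMN

end

noncomputable section

namespace GreenMN

/-! Symmetric functions are modelled by polynomials in the power sums (`Sym`, where `X i` is
p_{i+1}), with the scalar product for which the p_λ are orthogonal of norm z_λ(t). In terms of
vertex operators, Q_λ = H_{λ₁} ⋯ H_{λ_l} · 1 (`finsum_raiseTerm`), and this formula defines Q_α
(`QL`) for every integer sequence α. The Q_λ are orthogonal with norms b_λ (`form_QL`), so P_λ and
Q_λ are dual and X^λ_μ = ⟨p_μ, Q_λ⟩ (`green_eq`).

The adjoint p_k^⊥ of multiplication by p_k is a multiple of ∂/∂p_k. It kills 1 and satisfies p_k^⊥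
H_m = H_m p_k^⊥ + H_{m-k} (`pp_H`), hence p_k^⊥ Q_λ = Σ_j Q_{λ-kε_j} (`pp_QL`). Moving the factor
p_{μ₁} of p_μ across the scalar product gives X^λ_μ = Σ_j ⟨p_{μ^{[1]}}, Q_{λ-μ₁ε_j}⟩.

A quadratic relation between the H_m (`H_H`), iterated inwards, expands H_x H_y with x < y in the
products H_{y-a} H_{x+a} with exactly the coefficients C(S_{i,a}) (`H_H_straighten`). Repeating this
at the selected ascents terminates, because each move lowers a position-weighted sum of the entries;
a weakly decreasing sequence with a negative entry contributes 0. This is `straightening`.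

Orthogonality comes from the adjoint operators `Hs m`, built from the inverse of the series Σ q_n
z^n: the mixed relation `Hs_H` shows that `Hs m` strips a largest row m up to a scalar (`Hs_QL`).
Linear independence of the p_μ as power series transfers the result from `Sym` to `V`. -/

/-! ### Power series with a prescribed logarithmic derivative -/

/-- `y` has constant term `1` and `y' = P y`, that is, `y = exp (∫ P)`. -/
structure IsExpOf {R : Type*} [CommRing R] (P y : PowerSeries R) : Prop where
  const : PowerSeries.constantCoeff y = 1
  ode : PowerSeries.derivative R y = P * y

namespace IsExpOf

variable {R R' : Type*} [CommRing R] [CommRing R']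

theorem mul {P P' y y' : PowerSeries R} (h : IsExpOf P y) (h' : IsExpOf P' y') :
    IsExpOf (P + P') (y * y') where
  const := by simp [h.const, h'.const]
  ode := by
    rw [Derivation.leibniz, h.ode, h'.ode]
    simp only [smul_eq_mul]
    ring

theorem map (f : R →+* R') {P y : PowerSeries R} (h : IsExpOf P y) :
    IsExpOf (PowerSeries.map f P) (PowerSeries.map f y) where
  const := by
    have := congrArg f h.const
    rw [← PowerSeries.coeff_zero_eq_constantCoeff_apply] at this ⊢
    simpa using this
  ode := by
    rw [← map_mul, ← h.ode]
    ext n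
    simp [PowerSeries.coeff_derivative]

/-- The equation expresses (n+1) y_{n+1} through earlier coefficients, and n+1 can be cancelled in
characteristic zero. -/
theorem unique [IsDomain R] [CharZero R] {P y y' : PowerSeries R} (h : IsExpOf P y)
    (h' : IsExpOf P y') : y = y' := by
  ext n
  induction n using Nat.strong_induction_on with
  | _ n ih =>
    cases n with
    | zero => simpa using h.const.trans h'.const.symm
    | succ n =>
      have e := congrArg (PowerSeries.coeff n) h.ode
      have e' := congrArg (PowerSeries.coeff n) h'.ode
      rw [PowerSeries.coeff_derivative, PowerSeries.coeff_mul] at e e'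
      have hs : ∑ p ∈ Finset.HasAntidiagonal.antidiagonal n, PowerSeries.coeff p.1 P * PowerSeries.coeff p.2 y =
          ∑ p ∈ Finset.HasAntidiagonal.antidiagonal n, PowerSeries.coeff p.1 P * PowerSeries.coeff p.2 y' := by
        refine Finset.sum_congr rfl fun p hp => ?_
        rw [ih p.2]
        have := Finset.HasAntidiagonal.mem_antidiagonal.mp hp
        omega
      rw [hs, ← e'] at e
      have hn : (n : R) + 1 ≠ 0 := by exact_mod_cast Nat.succ_ne_zero n
      exact mul_right_cancel₀ hn e

theorem one_sub (c : R) :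
    IsExpOf (PowerSeries.mk fun i => -c ^ (i + 1))
      (1 - PowerSeries.C c * PowerSeries.X) where
  const := by simp
  ode := by
    ext n
    cases n with
    | zero => simp [mul_sub, ← mul_assoc]
    | succ n =>
      rw [mul_sub, ← mul_assoc, map_sub (PowerSeries.coeff (n + 1)),
        PowerSeries.coeff_succ_mul_X]
      simp [pow_succ]

end IsExpOf

/-! ### The polynomial model of the ring of symmetric functions -/

/-- The polynomial ring in the power sums; the variable `X i` stands for `p_{i+1}`. -/
abbrev Sym : Type := MvPolynomial ℕ F

/-- `(1 - t ^ k) / k` for `k = i + 1`. -/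
def cc (i : ℕ) : F := (1 - t ^ (i + 1)) / ((i : F) + 1)

theorem one_sub_t_pow_ne_zero {k : ℕ} (hk : k ≠ 0) : (1 : F) - t ^ k ≠ 0 := by
  intro h
  have h1 : (RatFunc.X : RatFunc ℚ) ^ k = 1 := (sub_eq_zero.mp h).symm
  rw [← RatFunc.algebraMap_X, ← map_pow, ← map_one (algebraMap (Polynomial ℚ) (RatFunc ℚ))] at h1
  have h2 := RatFunc.algebraMap_injective ℚ h1
  have := congrArg Polynomial.natDegree h2
  simp at this
  exact hk this

theorem cast_succ_ne_zero (i : ℕ) : (i : F) + 1 ≠ 0 := by exact_mod_cast Nat.succ_ne_zero i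

theorem cc_ne_zero (i : ℕ) : cc i ≠ 0 :=
  div_ne_zero (one_sub_t_pow_ne_zero (Nat.succ_ne_zero i)) (cast_succ_ne_zero i)

/-- The degree of a monomial in the power sums. -/
def wt : (ℕ →₀ ℕ) →+ ℕ :=
  Finsupp.liftAddHom fun i => (AddMonoidHom.mulRight (i + 1))

@[simp] theorem wt_single (i e : ℕ) : wt (Finsupp.single i e) = e * (i + 1) := by
  simp [wt]

/-- The coefficient of a monomial of degree `n` in `q_n`. -/
def zinv (m : ℕ →₀ ℕ) : F := m.prod fun i e => cc i ^ e / (e.factorial : F)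

theorem zinv_ne_zero (m : ℕ →₀ ℕ) : zinv m ≠ 0 :=
  Finset.prod_ne_zero_iff.mpr fun i _ =>
    div_ne_zero (pow_ne_zero _ (cc_ne_zero i)) (by exact_mod_cast Nat.factorial_ne_zero _)

/-- This one-step recursion for 1/z_λ(t) is behind both `pp_qI` and the adjointness `form_X_mul`. -/
theorem zinv_add_single (m : ℕ →₀ ℕ) (i : ℕ) :
    zinv (m + Finsupp.single i 1) * ((m i : F) + 1) = cc i * zinv m := by
  have h0 : ∀ j, cc j ^ 0 / ((Nat.factorial 0 : ℕ) : F) = 1 := by simp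
  have e1 : ∀ m : ℕ →₀ ℕ, zinv m =
      (cc i ^ m i / ((m i).factorial : F)) *
        (m.erase i).prod fun i e => cc i ^ e / (e.factorial : F) := fun m =>
    (Finsupp.mul_prod_erase' m i _ fun _ => h0 _).symm
  rw [e1, e1 m]
  have e2 : (m + Finsupp.single i 1).erase i = m.erase i := by
    rw [Finsupp.erase_add, Finsupp.erase_single, add_zero]
  rw [e2]
  simp only [Finsupp.add_apply, Finsupp.single_eq_same, Nat.factorial_succ, pow_succ]
  have h1 : ((m i).factorial : F) ≠ 0 := by exact_mod_cast Nat.factorial_ne_zero _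
  have h2 := cast_succ_ne_zero (m i)
  push_cast
  field_simp

theorem prod_map_X (s : Multiset ℕ) :
    (s.map (MvPolynomial.X : ℕ → Sym)).prod = MvPolynomial.monomial (Multiset.toFinsupp s) 1 := by
  induction s using Multiset.induction_on with
  | empty => simp
  | cons a s ih =>
    rw [Multiset.map_cons, Multiset.prod_cons, ih, ← Multiset.singleton_add, map_add,
      Multiset.toFinsupp_singleton, MvPolynomial.X, MvPolynomial.monomial_mul, one_mul]

theorem wt_toFinsupp (s : Multiset ℕ) : wt (Multiset.toFinsupp s) = (s.map (· + 1)).sum := by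
  induction s using Multiset.induction_on with
  | empty => simp
  | cons a s ih =>
    rw [← Multiset.singleton_add, map_add, map_add, ih]
    simp

/-- The power sum `p_k` for `k ≥ 1` as a variable. -/
def pS (k : ℕ) : Sym := MvPolynomial.X (k - 1)

/-- `p_μ` as a monomial. -/
def powS {n : ℕ} (mu : n.Partition) : Sym := (mu.parts.map pS).prod

/-- The exponent vector of `p_μ`. -/
def expo {n : ℕ} (mu : n.Partition) : ℕ →₀ ℕ := Multiset.toFinsupp (mu.parts.map (· - 1))

theorem map_pred_succ {n : ℕ} (mu : n.Partition) :
    (mu.parts.map (· - 1)).map (· + 1) = mu.parts := by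
  rw [Multiset.map_map]
  conv_rhs => rw [← Multiset.map_id mu.parts]
  refine Multiset.map_congr rfl fun x hx => ?_
  have := mu.parts_pos hx
  simp
  omega

theorem powS_eq {n : ℕ} (mu : n.Partition) : powS mu = MvPolynomial.monomial (expo mu) 1 := by
  rw [expo, ← prod_map_X, Multiset.map_map]
  rfl

theorem wt_expo {n : ℕ} (mu : n.Partition) : wt (expo mu) = n := by
  rw [expo, wt_toFinsupp, map_pred_succ, mu.parts_sum]

/-- The partition with a given exponent vector. -/
def ofExpo (m : ℕ →₀ ℕ) : (wt m).Partition where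
  parts := (Finsupp.toMultiset m).map (· + 1)
  parts_pos := by
    intro i hi
    obtain ⟨j, -, rfl⟩ := Multiset.mem_map.mp hi
    omega
  parts_sum := by rw [← wt_toFinsupp, Finsupp.toMultiset_toFinsupp]

theorem expo_ofExpo (m : ℕ →₀ ℕ) : expo (ofExpo m) = m := by
  simp [expo, ofExpo]

theorem expo_injective {n : ℕ} : Function.Injective (expo (n := n)) := by
  intro a b h
  have := Multiset.toFinsupp.injective h
  ext1
  rw [← map_pred_succ a, this, map_pred_succ]

theorem zt_inv {n : ℕ} (lam : n.Partition) : (zt lam)⁻¹ = zinv (expo lam) := by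
  set s := lam.parts.map (· - 1) with hs
  have hp : lam.parts = s.map (· + 1) := (map_pred_succ lam).symm
  rw [zt, zinv, expo, ← hs, inv_div, Finset.prod_multiset_map_count, hp, Finsupp.prod,
    ← Finset.prod_div_distrib, Multiset.toFinset_map, Finset.prod_image (by simp)]
  simp only [Multiset.toFinsupp_support, Multiset.toFinsupp_apply]
  refine Finset.prod_congr rfl fun i _ => ?_
  rw [Multiset.count_map_eq_count' _ _ (add_left_injective 1), cc, div_pow, div_div]
  push_cast
  rfl

/-- `q_n` in terms of the power sums. -/
def qS (n : ℕ) : Sym := ∑ lam : n.Partition, (zt lam)⁻¹ • powS lam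

theorem coeff_qS (n : ℕ) (m : ℕ →₀ ℕ) :
    MvPolynomial.coeff m (qS n) = if wt m = n then zinv m else 0 := by
  rw [qS, MvPolynomial.coeff_sum]
  simp only [MvPolynomial.coeff_smul, powS_eq, zt_inv, MvPolynomial.coeff_monomial, smul_eq_mul,
    mul_ite, mul_one, mul_zero]
  split_ifs with h
  · subst h
    rw [Finset.sum_eq_single (ofExpo m)]
    · simp [expo_ofExpo]
    · intro b _ hb
      rw [if_neg]
      intro hbm
      exact hb (expo_injective (hbm.trans (expo_ofExpo m).symm))
    · simp
  · refine Finset.sum_eq_zero fun b _ => ?_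
    rw [if_neg]
    rintro rfl
    exact h (wt_expo b)

/-- `q_k` for an integer `k`. -/
def qI (k : ℤ) : Sym := if k < 0 then 0 else qS k.toNat

theorem coeff_qI (k : ℤ) (m : ℕ →₀ ℕ) :
    MvPolynomial.coeff m (qI k) = if (wt m : ℤ) = k then zinv m else 0 := by
  unfold qI
  split_ifs with h1 h2 h2
  · omega
  · simp
  · rw [coeff_qS, if_pos (by omega)]
  · rw [coeff_qS, if_neg (by omega)]

/-- The adjoint of multiplication by `p_{i+1}`. -/
def pp (i : ℕ) : Derivation F Sym Sym := (cc i)⁻¹ • MvPolynomial.pderiv i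

theorem coeff_pp (i : ℕ) (f : Sym) (m : ℕ →₀ ℕ) : MvPolynomial.coeff m (pp i f) =
    (cc i)⁻¹ * (MvPolynomial.coeff (m + Finsupp.single i 1) f * ((m i : F) + 1)) := by
  rw [pp, Derivation.smul_apply, MvPolynomial.coeff_smul, MvPolynomial.coeff_pderiv, smul_eq_mul]

/-- On q(z) = exp Σ (1-t^k)/k p_k z^k the operator p_k^⊥ acts as multiplication by z^k. -/
theorem pp_qI (i : ℕ) (k : ℤ) : pp i (qI k) = qI (k - (i + 1)) := by
  ext m
  rw [coeff_pp, coeff_qI, coeff_qI]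
  simp only [map_add, wt_single]
  by_cases h : (wt m : ℤ) = k - (i + 1)
  · rw [if_pos h, if_pos (by push_cast; omega), zinv_add_single, inv_mul_cancel_left₀ (cc_ne_zero i)]
  · rw [if_neg h, if_neg (by push_cast; omega)]
    simp

/-! ### The series of the q_n, its differential equation and its inverse -/

/-- The generating series of the `q_n`. -/
def qP : PowerSeries Sym := PowerSeries.mk qS

theorem qS_zero : qS 0 = 1 := by
  ext m
  rw [coeff_qS, MvPolynomial.coeff_one]
  have h : wt m = 0 ↔ 0 = m := by
    constructor
    · intro h
      ext i
      by_contra hi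
      have h1 : wt m = wt (m.erase i) + wt (Finsupp.single i (m i)) := by
        rw [← map_add, Finsupp.erase_add_single]
      rw [h, wt_single] at h1
      have : m i * (i + 1) ≠ 0 := mul_ne_zero (fun h => hi (by simp [h])) (Nat.succ_ne_zero i)
      omega
    · rintro rfl
      simp
  simp only [h]
  split_ifs with h'
  · subst h'
    simp [zinv]
  · rfl

/-- The Euler operator Σ k p_k ∂/∂p_k multiplies a monomial by its degree; a variable p_k with k > N
cannot divide a monomial of degree N. -/
theorem euler (N : ℕ) (m : ℕ →₀ ℕ) (h : wt m = N) (r : F) :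
    ∑ i ∈ Finset.range N, ((i : F) + 1) •
      (MvPolynomial.X i * MvPolynomial.pderiv i (MvPolynomial.monomial m r)) =
      (N : F) • MvPolynomial.monomial m r := by
  have hsup : m.support ⊆ Finset.range N := by
    intro i hi
    rw [Finset.mem_range]
    have h1 : wt m = wt (m.erase i) + wt (Finsupp.single i (m i)) := by
      rw [← map_add, Finsupp.erase_add_single]
    rw [wt_single] at h1
    have h2 : 1 ≤ m i := Nat.one_le_iff_ne_zero.mpr (Finsupp.mem_support_iff.mp hi)
    nlinarith
  have hw : wt m = ∑ i ∈ Finset.range N, m i * (i + 1) := by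
    simp only [wt, Finsupp.liftAddHom_apply, AddMonoidHom.coe_mulRight]
    exact Finsupp.sum_of_support_subset _ hsup _ (by simp)
  simp only [MvPolynomial.X_mul_pderiv_monomial, ← Nat.cast_smul_eq_nsmul F, smul_smul]
  rw [← Finset.sum_smul]
  congr 1
  rw [← h, hw]
  push_cast
  rw [← hw, h]
  exact Finset.sum_congr rfl fun i _ => mul_comm _ _

theorem qS_newton (n : ℕ) : ((n : F) + 1) • qS (n + 1) =
    ∑ i ∈ Finset.range (n + 1),
      (1 - t ^ (i + 1)) • ((MvPolynomial.X i : Sym) * qS (n - i)) := by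
  have h1 : ∀ i ∈ Finset.range (n + 1),
      (1 - t ^ (i + 1)) • ((MvPolynomial.X i : Sym) * qS (n - i)) =
      ((i : F) + 1) • (MvPolynomial.X i * MvPolynomial.pderiv i (qS (n + 1))) := by
    intro i hi
    have hi' := Finset.mem_range.mp hi
    have h2 := pp_qI i (n + 1)
    rw [show (n : ℤ) + 1 - (i + 1) = ((n - i : ℕ) : ℤ) by omega,
      show (n : ℤ) + 1 = ((n + 1 : ℕ) : ℤ) by push_cast; ring, qI, qI, if_neg (by omega),
      if_neg (by omega), Int.toNat_natCast, Int.toNat_natCast, pp, Derivation.smul_apply] at h2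
    rw [← h2, mul_smul_comm, smul_smul, cc]
    congr 1
    have := one_sub_t_pow_ne_zero (Nat.succ_ne_zero i)
    have := cast_succ_ne_zero i
    field_simp
  rw [Finset.sum_congr rfl h1, qS]
  simp only [map_sum, Finset.mul_sum, Finset.smul_sum]
  rw [Finset.sum_comm]
  refine Finset.sum_congr rfl fun lam _ => ?_
  rw [powS_eq, MvPolynomial.smul_monomial, euler (n + 1) _ (wt_expo lam)]
  push_cast
  rfl

theorem qP_isExp :
    IsExpOf (PowerSeries.mk fun i => (1 - t ^ (i + 1)) • (MvPolynomial.X i : Sym)) qP where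
  const := by
    rw [← PowerSeries.coeff_zero_eq_constantCoeff_apply, qP, PowerSeries.coeff_mk, qS_zero]
  ode := by
    ext1 n
    rw [PowerSeries.coeff_derivative, PowerSeries.coeff_mul,
      Finset.Nat.sum_antidiagonal_eq_sum_range_succ_mk]
    simp only [qP, PowerSeries.coeff_mk, smul_mul_assoc]
    rw [← qS_newton, mul_comm, Algebra.smul_def, map_add, map_natCast, map_one]

/-- The inverse series of `qP`. -/
def rP : PowerSeries Sym := PowerSeries.invOfUnit qP 1

theorem qP_mul_rP : qP * rP = 1 :=
  PowerSeries.mul_invOfUnit _ _ (by rw [qP_isExp.const]; rfl)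

/-- The coefficients of the inverse series of `qP`, extended by `0` to negative indices. -/
def rI (k : ℤ) : Sym := if k < 0 then 0 else PowerSeries.coeff k.toNat rP

theorem qI_natCast (n : ℕ) : qI n = PowerSeries.coeff n qP := by
  simp [qI, qP]

theorem rI_natCast (n : ℕ) : rI n = PowerSeries.coeff n rP := by
  simp [rI]

theorem qI_neg {k : ℤ} (h : k < 0) : qI k = 0 := if_pos h

theorem rI_neg {k : ℤ} (h : k < 0) : rI k = 0 := if_pos h

theorem qI_zero : qI 0 = 1 := by simp [qI, qS_zero]

theorem rI_zero : rI 0 = 1 := by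
  have h := congrArg (PowerSeries.coeff 0) qP_mul_rP
  simp only [PowerSeries.coeff_zero_eq_constantCoeff, map_mul, map_one] at h
  simp only [← PowerSeries.coeff_zero_eq_constantCoeff] at h
  have h0 := qI_natCast 0
  have h1 := rI_natCast 0
  rw [Nat.cast_zero] at h0 h1
  rw [qI_zero] at h0
  rw [← h0, ← h1] at h
  simpa using h

/-! ### Effect of p_k ↦ p_k ± X^k on the q_n and on the inverse series -/

/-- The algebra map `p_k ↦ p_k + s X ^ k`. -/
def shift (s : F) : Sym →ₐ[F] Polynomial Sym :=
  MvPolynomial.aeval fun i =>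
    Polynomial.C (MvPolynomial.X i : Sym) + s • (Polynomial.X : Polynomial Sym) ^ (i + 1)

theorem shift_X (s : F) (i : ℕ) : shift s (MvPolynomial.X i) =
    Polynomial.C (MvPolynomial.X i : Sym) + s • (Polynomial.X : Polynomial Sym) ^ (i + 1) := by
  simp [shift]

theorem shift_smul (s a : F) (f : Sym) : shift s (a • f) = a • shift s f := map_smul _ _ _

theorem C_smul (a : F) (f : Sym) : Polynomial.C (a • f) = a • Polynomial.C f :=
  (Polynomial.smul_C a f).symm

/-- Constants as series over `Sym[X]`. -/
abbrev constMap : PowerSeries Sym →+* PowerSeries (Polynomial Sym) :=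
  PowerSeries.map Polynomial.C

/-- The series of shifts. -/
abbrev shiftMap (s : F) : PowerSeries Sym →+* PowerSeries (Polynomial Sym) :=
  PowerSeries.map (shift s).toRingHom

/-- Under p_k ↦ p_k - X^k the logarithmic derivative of q(z) changes by -Σ (1-t^k) X^k z^{k-1},
which is that of (1-Xz)/(1-tXz). With denominators cleared, both sides solve the same differential
equation. -/
theorem shiftMap_neg_one_qP : shiftMap (-1) qP *
      (1 - PowerSeries.C (t • (Polynomial.X : Polynomial Sym)) * PowerSeries.X) =
    constMap qP * (1 - PowerSeries.C (Polynomial.X : Polynomial Sym) * PowerSeries.X) := by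
  have h1 := (qP_isExp.map (shift (-1)).toRingHom).mul
    (IsExpOf.one_sub (t • (Polynomial.X : Polynomial Sym)))
  have h2 := (qP_isExp.map (Polynomial.C : Sym →+* Polynomial Sym)).mul
    (IsExpOf.one_sub (Polynomial.X : Polynomial Sym))
  refine h1.unique ?_
  convert h2 using 1
  ext1 n
  simp only [map_add, PowerSeries.coeff_map, PowerSeries.coeff_mk, smul_pow,
    AlgHom.toRingHom_eq_coe, RingHom.coe_coe, shift_smul, shift_X, C_smul]
  simp only [neg_smul, one_smul, smul_add, sub_smul, smul_neg]
  abel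

theorem shiftMap_one_qP : shiftMap 1 qP *
      (1 - PowerSeries.C (Polynomial.X : Polynomial Sym) * PowerSeries.X) =
    constMap qP * (1 - PowerSeries.C (t • (Polynomial.X : Polynomial Sym)) * PowerSeries.X) := by
  have h1 := (qP_isExp.map (shift 1).toRingHom).mul
    (IsExpOf.one_sub (Polynomial.X : Polynomial Sym))
  have h2 := (qP_isExp.map (Polynomial.C : Sym →+* Polynomial Sym)).mul
    (IsExpOf.one_sub (t • (Polynomial.X : Polynomial Sym)))
  refine h1.unique ?_
  convert h2 using 1
  ext1 n
  simp only [map_add, PowerSeries.coeff_map, PowerSeries.coeff_mk, smul_pow,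
    AlgHom.toRingHom_eq_coe, RingHom.coe_coe, shift_smul, shift_X, C_smul]
  simp only [one_smul, smul_add, sub_smul]
  abel

theorem shiftMap_neg_one_rP : shiftMap (-1) rP *
      (1 - PowerSeries.C (Polynomial.X : Polynomial Sym) * PowerSeries.X) =
    constMap rP * (1 - PowerSeries.C (t • (Polynomial.X : Polynomial Sym)) * PowerSeries.X) := by
  have h1 := shiftMap_neg_one_qP
  have h2 : shiftMap (-1) qP * shiftMap (-1) rP = 1 := by rw [← map_mul, qP_mul_rP, map_one]
  have h3 : constMap qP * constMap rP = 1 := by rw [← map_mul, qP_mul_rP, map_one]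
  linear_combination (-shiftMap (-1) rP * constMap rP) * h1 +
    constMap rP * (1 - PowerSeries.C (t • (Polynomial.X : Polynomial Sym)) * PowerSeries.X) * h2 -
    shiftMap (-1) rP * (1 - PowerSeries.C (Polynomial.X : Polynomial Sym) * PowerSeries.X) * h3

/-- Coefficients of an identity `y (1 - c x) = y' (1 - c' x)`, extended to integer indices. -/
theorem coeff_identity {R : Type*} [CommRing R] {y y' : PowerSeries R} {c c' : R}
    (h : y * (1 - PowerSeries.C c * PowerSeries.X) = y' * (1 - PowerSeries.C c' * PowerSeries.X))
    (Y Y' : ℤ → R) (hY : ∀ n : ℕ, Y n = PowerSeries.coeff n y)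
    (hY' : ∀ n : ℕ, Y' n = PowerSeries.coeff n y')
    (hn : ∀ k < 0, Y k = 0) (hn' : ∀ k < 0, Y' k = 0) (k : ℤ) :
    Y k = c * Y (k - 1) + Y' k - c' * Y' (k - 1) := by
  rcases lt_or_ge k 0 with hk | hk
  · rw [hn k hk, hn _ (by omega), hn' k hk, hn' _ (by omega)]
    simp
  · lift k to ℕ using hk
    have hc := congrArg (PowerSeries.coeff k) h
    rw [mul_sub, mul_sub, map_sub, map_sub, mul_one, mul_one, mul_left_comm, mul_left_comm y',
      PowerSeries.coeff_C_mul, PowerSeries.coeff_C_mul] at hc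
    cases k with
    | zero =>
      rw [PowerSeries.coeff_zero_mul_X, PowerSeries.coeff_zero_mul_X] at hc
      rw [hn ((0 : ℕ) - 1) (by simp), hn' ((0 : ℕ) - 1) (by simp), hY, hY']
      linear_combination hc
    | succ k =>
      rw [PowerSeries.coeff_succ_mul_X, PowerSeries.coeff_succ_mul_X] at hc
      rw [show ((k + 1 : ℕ) : ℤ) - 1 = k by push_cast; ring, hY, hY', hY, hY']
      linear_combination hc

theorem shift_neg_one_qI (k : ℤ) : shift (-1) (qI k) =
    (t • (Polynomial.X : Polynomial Sym)) * shift (-1) (qI (k - 1)) + Polynomial.C (qI k) -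
      Polynomial.X * Polynomial.C (qI (k - 1)) :=
  coeff_identity shiftMap_neg_one_qP (fun k => shift (-1) (qI k)) (fun k => Polynomial.C (qI k))
    (fun n => by simp [qI_natCast]) (fun n => by simp [qI_natCast])
    (fun k hk => by simp [qI_neg hk]) (fun k hk => by simp [qI_neg hk]) k

theorem shift_one_qI (k : ℤ) : shift 1 (qI k) =
    (Polynomial.X : Polynomial Sym) * shift 1 (qI (k - 1)) + Polynomial.C (qI k) -
      (t • (Polynomial.X : Polynomial Sym)) * Polynomial.C (qI (k - 1)) :=
  coeff_identity shiftMap_one_qP (fun k => shift 1 (qI k)) (fun k => Polynomial.C (qI k))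
    (fun n => by simp [qI_natCast]) (fun n => by simp [qI_natCast])
    (fun k hk => by simp [qI_neg hk]) (fun k hk => by simp [qI_neg hk]) k

theorem shift_neg_one_rI (k : ℤ) : shift (-1) (rI k) =
    (Polynomial.X : Polynomial Sym) * shift (-1) (rI (k - 1)) + Polynomial.C (rI k) -
      (t • (Polynomial.X : Polynomial Sym)) * Polynomial.C (rI (k - 1)) :=
  coeff_identity shiftMap_neg_one_rP (fun k => shift (-1) (rI k)) (fun k => Polynomial.C (rI k))
    (fun n => by simp [rI_natCast]) (fun n => by simp [rI_natCast])
    (fun k hk => by simp [rI_neg hk]) (fun k hk => by simp [rI_neg hk]) k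

/-- Applied coefficientwise, p_k^⊥ is a derivation `d` on series; from q r = 1 and d q = z^k q it
follows that d r = -z^k r. -/
theorem pp_rI (i : ℕ) (k : ℤ) : pp i (rI k) = -rI (k - (i + 1)) := by
  let d : PowerSeries Sym → PowerSeries Sym := fun y =>
    PowerSeries.mk fun n => pp i (PowerSeries.coeff n y)
  have hd : ∀ y z, d (y * z) = y * d z + z * d y := by
    intro y z
    rw [mul_comm z]
    ext1 n
    simp only [d, PowerSeries.coeff_mk, PowerSeries.coeff_mul, map_add, map_sum,
      Derivation.leibniz, smul_eq_mul, Finset.sum_add_distrib]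
    congr 1
    exact Finset.sum_congr rfl fun _ _ => mul_comm _ _
  have hX : ∀ (y : PowerSeries Sym) (Y : ℤ → Sym), (∀ n : ℕ, Y n = PowerSeries.coeff n y) →
      (∀ k < 0, Y k = 0) → ∀ n : ℕ, PowerSeries.coeff n (PowerSeries.X ^ (i + 1) * y) =
        Y (n - (i + 1)) := by
    intro y Y hY hn n
    rw [PowerSeries.coeff_X_pow_mul']
    split_ifs with h
    · rw [← hY]
      congr 1
      omega
    · rw [hn]
      omega
  have hq : d qP = PowerSeries.X ^ (i + 1) * qP := by
    ext1 n
    rw [hX qP qI qI_natCast fun k hk => qI_neg hk]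
    simp only [d, PowerSeries.coeff_mk]
    rw [← qI_natCast, pp_qI]
  have h1 : d (qP * rP) = 0 := by
    rw [qP_mul_rP]
    ext1 n
    simp only [d, PowerSeries.coeff_mk, PowerSeries.coeff_one]
    split_ifs <;> simp
  rw [hd, hq] at h1
  have hr : d rP = -(PowerSeries.X ^ (i + 1) * rP) := by
    linear_combination rP * h1 - (d rP + PowerSeries.X ^ (i + 1) * rP) * qP_mul_rP
  rcases lt_or_ge k 0 with hk | hk
  · rw [rI_neg hk, rI_neg (by omega)]
    simp
  · lift k to ℕ using hk
    have := congrArg (PowerSeries.coeff k) hr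
    rw [map_neg, hX rP rI rI_natCast fun k hk => rI_neg hk] at this
    simp only [d, PowerSeries.coeff_mk] at this
    rw [← this, rI_natCast]

/-! ### Vertex operators -/

/-- The parameter `t` as a constant polynomial. -/
def T : Sym := algebraMap F Sym t

theorem t_smul (f : Sym) : t • f = T * f := Algebra.smul_def _ _

/-- The linear functional `X ^ j ↦ y (m + j)`. -/
def ev (y : ℤ → Sym) (m : ℤ) : Polynomial Sym →ₗ[Sym] Sym :=
  Polynomial.lsum fun j => LinearMap.toSpanSingleton Sym Sym (y (m + j))

theorem ev_monomial (y : ℤ → Sym) (m : ℤ) (j : ℕ) (a : Sym) :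
    ev y m (Polynomial.monomial j a) = a * y (m + j) := by
  simp [ev, Polynomial.lsum_apply, Polynomial.sum_monomial_index]

theorem ev_C (y : ℤ → Sym) (m : ℤ) (a : Sym) : ev y m (Polynomial.C a) = a * y m := by
  rw [← Polynomial.monomial_zero_left, ev_monomial]
  simp

theorem ev_X_pow_mul (y : ℤ → Sym) (m : ℤ) (k : ℕ) (g : Polynomial Sym) :
    ev y m (Polynomial.X ^ k * g) = ev y (m + k) g := by
  induction g using Polynomial.induction_on' with
  | add p q hp hq => rw [mul_add, map_add, map_add, hp, hq]
  | monomial n a =>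
    rw [Polynomial.X_pow_mul_monomial, ev_monomial, ev_monomial]
    congr 2
    push_cast
    ring

theorem ev_X_mul (y : ℤ → Sym) (m : ℤ) (g : Polynomial Sym) :
    ev y m (Polynomial.X * g) = ev y (m + 1) g := by
  have := ev_X_pow_mul y m 1 g
  simpa using this

theorem ev_C_mul (y : ℤ → Sym) (m : ℤ) (a : Sym) (g : Polynomial Sym) :
    ev y m (Polynomial.C a * g) = a * ev y m g := by
  rw [← Polynomial.smul_eq_C_mul, map_smul, smul_eq_mul]

theorem t_smul_X : t • (Polynomial.X : Polynomial Sym) = Polynomial.C T * Polynomial.X := by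
  rw [Algebra.smul_def]
  rfl

/-- The operator sending `f` to `∑_j y_{m+j} f_j`, where `∑_j f_j X^j` is the shift of `f`. -/
def vert (s : F) (y : ℤ → Sym) (m : ℤ) : Sym →ₗ[F] Sym :=
  (ev y m).restrictScalars F ∘ₗ (shift s).toLinearMap

theorem vert_apply (s : F) (y : ℤ → Sym) (m : ℤ) (f : Sym) :
    vert s y m f = ev y m (shift s f) := rfl

theorem vert_one (s : F) (y : ℤ → Sym) (m : ℤ) : vert s y m 1 = y m := by
  rw [vert_apply, map_one, ← map_one Polynomial.C, ev_C, one_mul]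

theorem vert_X_mul (s : F) (y : ℤ → Sym) (m : ℤ) (i : ℕ) (f : Sym) :
    vert s y m (MvPolynomial.X i * f) =
      MvPolynomial.X i * vert s y m f + s • vert s y (m + (i + 1)) f := by
  simp only [vert_apply]
  rw [map_mul, shift_X, add_mul, map_add, ev_C_mul, smul_mul_assoc, ← algebraMap_smul Sym s,
    map_smul, ev_X_pow_mul, algebraMap_smul]
  push_cast
  rfl

/-- The vertex operator `H_m`, which prepends a row of length `m`. -/
def H (m : ℤ) : Sym →ₗ[F] Sym := vert (-1) qI m

/-- The adjoint of `H m`. -/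
def Hs (m : ℤ) : Sym →ₗ[F] Sym := vert 1 rI (-m)

theorem H_one (m : ℤ) : H m 1 = qI m := vert_one _ _ _

theorem Hs_one (m : ℤ) : Hs m 1 = rI (-m) := vert_one _ _ _

theorem H_X_mul (m : ℤ) (i : ℕ) (f : Sym) :
    H m (MvPolynomial.X i * f) = MvPolynomial.X i * H m f - H (m + (i + 1)) f := by
  rw [H, vert_X_mul, neg_one_smul, ← sub_eq_add_neg]
  rfl

theorem Hs_X_mul (m : ℤ) (i : ℕ) (f : Sym) :
    Hs m (MvPolynomial.X i * f) = MvPolynomial.X i * Hs m f + Hs (m - (i + 1)) f := by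
  rw [Hs, vert_X_mul, one_smul, Hs, neg_sub', sub_neg_eq_add]

/-- This is the recursion for the shifted q_n read through `ev`: each factor X raises the index of
the vertex operator by one. The next two lemmas arise in the same way. -/
theorem H_qI (m n : ℤ) : H m (qI n) =
    T * H (m + 1) (qI (n - 1)) + qI n * qI m - qI (n - 1) * qI (m + 1) := by
  simp only [H, vert_apply]
  conv_lhs => rw [shift_neg_one_qI, map_sub, map_add, ev_X_mul, ev_C, ev_C, t_smul_X, mul_assoc,
    ev_C_mul, ev_X_mul]

theorem H_rI (m n : ℤ) : H m (rI n) =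
    H (m + 1) (rI (n - 1)) + rI n * qI m - T * (rI (n - 1) * qI (m + 1)) := by
  simp only [H, vert_apply]
  conv_lhs => rw [shift_neg_one_rI, map_sub, map_add, ev_X_mul, ev_C, t_smul_X, mul_assoc,
    ev_C_mul, ev_X_mul, ev_C]

theorem Hs_qI (m n : ℤ) : Hs m (qI n) =
    Hs (m - 1) (qI (n - 1)) + qI n * rI (-m) - T * (qI (n - 1) * rI (-m + 1)) := by
  simp only [Hs, vert_apply, neg_sub', sub_neg_eq_add]
  conv_lhs => rw [shift_one_qI, map_sub, map_add, ev_X_mul, ev_C, t_smul_X, mul_assoc,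
    ev_C_mul, ev_X_mul, ev_C]

/-- Induction on symmetric functions, multiplying by power sums. -/
theorem sym_induction {P : Sym → Prop} (one : P 1) (smul : ∀ (a : F) f, P f → P (a • f))
    (add : ∀ f g, P f → P g → P (f + g)) (mul : ∀ i f, P f → P (MvPolynomial.X i * f))
    (f : Sym) : P f := by
  induction f using MvPolynomial.induction_on with
  | C a =>
    have := smul a 1 one
    rwa [Algebra.smul_def, mul_one] at this
  | add f g hf hg => exact add f g hf hg
  | mul_X f i hf =>
    rw [mul_comm]
    exact mul i f hf

/-! ### Commutation relations of the vertex operators -/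

/-- For f = 1, add `H_qI` at (m, n) and at (n-1, m+1). Multiplying f by p_k turns the relation into
p_k times itself minus its instances with m or n raised by k, so it propagates to all f. -/
theorem H_H (m n : ℤ) (f : Sym) :
    H m (H n f) - T * H (m + 1) (H (n - 1) f) + H (n - 1) (H (m + 1) f) - T * H n (H m f) = 0 := by
  induction f using sym_induction generalizing m n with
  | one =>
    simp only [H_one]
    have h1 := H_qI m n
    have h2 := H_qI (n - 1) (m + 1)
    rw [show n - 1 + 1 = n by ring, show m + 1 - 1 = m by ring] at h2
    linear_combination h1 + h2
  | smul a f hf =>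
    have := congrArg (a • ·) (hf m n)
    simp only [map_smul, mul_smul_comm] at this ⊢
    rw [← smul_sub, ← smul_add, ← smul_sub]
    exact this.trans (smul_zero a)
  | add f g hf hg =>
    simp only [map_add]
    linear_combination hf m n + hg m n
  | mul i f hf =>
    simp only [H_X_mul, map_sub]
    have h1 := hf (m + (i + 1)) n
    have h2 := hf m (n + (i + 1))
    rw [show m + (i + 1) + 1 = m + 1 + ((i : ℤ) + 1) by ring] at h1
    rw [show n + (i + 1) - 1 = n - 1 + ((i : ℤ) + 1) by ring] at h2
    linear_combination (MvPolynomial.X i : Sym) * hf m n - h1 - h2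

theorem pp_X_self (i : ℕ) : pp i (MvPolynomial.X i) = algebraMap F Sym (cc i)⁻¹ := by
  rw [pp, Derivation.smul_apply, MvPolynomial.pderiv_X_self, Algebra.smul_def, mul_one]

theorem pp_X_of_ne {i j : ℕ} (h : j ≠ i) : pp i (MvPolynomial.X j) = 0 := by
  rw [pp, Derivation.smul_apply, MvPolynomial.pderiv_X_of_ne h, smul_zero]

theorem pp_X (i j : ℕ) : ∃ a : F, pp i (MvPolynomial.X j) = algebraMap F Sym a := by
  by_cases h : j = i
  · subst h
    exact ⟨_, pp_X_self j⟩
  · exact ⟨0, by rw [pp_X_of_ne h, map_zero]⟩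

theorem pp_H (i : ℕ) (m : ℤ) (f : Sym) : pp i (H m f) = H m (pp i f) + H (m - (i + 1)) f := by
  induction f using sym_induction generalizing m with
  | one => simp [H_one, pp_qI]
  | smul a f hf => simp only [map_smul, Derivation.map_smul, hf, smul_add]
  | add f g hf hg =>
    simp only [map_add, hf, hg]
    ring
  | mul j f hf =>
    obtain ⟨a, ha⟩ := pp_X i j
    simp only [H_X_mul, map_sub, Derivation.leibniz, smul_eq_mul, ha, hf, map_add]
    rw [mul_comm f, ← Algebra.smul_def, map_smul, Algebra.smul_def,
      show m + (j + 1) - ((i : ℤ) + 1) = m - (i + 1) + (j + 1) by ring]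
    ring

theorem shift_one_qI_natCast (n : ℕ) : shift 1 (qI n) = Polynomial.C (qI n) +
    ∑ j ∈ Finset.range n, Polynomial.monomial (j + 1) ((1 - T) * qI (n - (j + 1))) := by
  induction n with
  | zero =>
    rw [Nat.cast_zero, qI_zero]
    simp
  | succ n ih =>
    rw [shift_one_qI, show ((n + 1 : ℕ) : ℤ) - 1 = n by push_cast; ring, ih, Finset.sum_range_succ',
      mul_add, Finset.mul_sum, t_smul_X]
    have h : ∀ j ∈ Finset.range n, (Polynomial.X : Polynomial Sym) *
        Polynomial.monomial (j + 1) ((1 - T) * qI (n - (j + 1))) =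
        Polynomial.monomial (j + 1 + 1) ((1 - T) * qI ((n + 1 : ℕ) - ((j + 1 : ℕ) + 1))) := by
      intro j _
      rw [Polynomial.X_mul_monomial]
      congr 3
      push_cast
      ring
    rw [Finset.sum_congr rfl h, ← Polynomial.C_mul_X_pow_eq_monomial,
      show ((n + 1 : ℕ) : ℤ) - ((0 : ℕ) + 1) = n by push_cast; ring]
    simp only [map_mul, map_sub, map_one]
    ring

theorem sum_qI_mul_rI (n : ℕ) :
    ∑ j ∈ Finset.range (n + 1), qI (n - j) * rI j = if n = 0 then 1 else 0 := by
  have h := congrArg (PowerSeries.coeff n) qP_mul_rP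
  rw [mul_comm, PowerSeries.coeff_mul, Finset.Nat.sum_antidiagonal_eq_sum_range_succ_mk,
    PowerSeries.coeff_one] at h
  rw [← h]
  refine Finset.sum_congr rfl fun j hj => ?_
  have := Finset.mem_range.mp hj
  rw [← qI_natCast, ← rI_natCast, mul_comm, Nat.cast_sub (by omega)]

/-- The shifted q_n is q_n + (1-t) Σ_{j≥1} q_{n-j} X^j. The constant term meets r_{-1} = 0, and the
rest gives (1-t) times a coefficient of q r = 1. -/
theorem Hs_one_qI (n : ℤ) : Hs 1 (qI n) = if n = 1 then 1 - T else 0 := by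
  rcases lt_or_ge n 0 with hn | hn
  · rw [qI_neg hn, map_zero, if_neg (by omega)]
  · lift n to ℕ using hn
    rw [Hs, vert_apply, shift_one_qI_natCast, map_add, map_sum, ev_C, rI_neg (by omega), mul_zero,
      zero_add]
    simp only [ev_monomial]
    cases n with
    | zero => simp
    | succ n =>
      have h : ∀ j ∈ Finset.range (n + 1),
          (1 - T) * qI ((n + 1 : ℕ) - (j + 1)) * rI (-1 + (j + 1 : ℕ)) =
          (1 - T) * (qI (n - j) * rI j) := by
        intro j _
        rw [mul_assoc, show ((n + 1 : ℕ) : ℤ) - (j + 1) = n - j by push_cast; ring,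
          show (-1 : ℤ) + (j + 1 : ℕ) = j by push_cast; ring]
      rw [Finset.sum_congr rfl h, ← Finset.mul_sum, sum_qI_mul_rI]
      simp

theorem Hs_qI_of_pos (m : ℕ) (n : ℤ) :
    Hs (m + 1) (qI n) = if n = m + 1 then 1 - T else 0 := by
  induction m generalizing n with
  | zero =>
    have := Hs_one_qI n
    simpa using this
  | succ m ih =>
    rw [Hs_qI, show ((m + 1 : ℕ) : ℤ) + 1 - 1 = m + 1 by push_cast; ring, ih,
      rI_neg (by omega), rI_neg (by omega)]
    have : n - 1 = m + 1 ↔ n = (m + 1 : ℕ) + 1 := by omega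
    simp [this]

/-- For m > 0 the terms with r_{-m} vanish and `Hs_qI_of_pos` applies; `Hs_qI` and `H_rI` carry the
identity from (m+1, n+1) down to (m, n). -/
theorem Hs_qI_add (m n : ℤ) :
    Hs m (qI n) + H n (rI (-m)) = (1 + T) * (qI n * rI (-m)) + if n = m then 1 - T else 0 := by
  have hpos : ∀ m : ℤ, 0 < m → ∀ n, Hs m (qI n) + H n (rI (-m)) =
      (1 + T) * (qI n * rI (-m)) + if n = m then 1 - T else 0 := by
    intro m hm n
    have h := Hs_qI_of_pos (m.toNat - 1) n
    rw [show ((m.toNat - 1 : ℕ) : ℤ) + 1 = m by omega] at h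
    rw [h, rI_neg (by omega), map_zero]
    ring
  obtain ⟨d, hd⟩ : ∃ d : ℕ, 0 < m + d := ⟨(1 - m).toNat, by omega⟩
  induction d generalizing m n with
  | zero => exact hpos m (by simpa using hd) n
  | succ d ih =>
    have h := ih (m + 1) (n + 1) (by push_cast at hd ⊢; omega)
    have h1 := Hs_qI (m + 1) (n + 1)
    have h2 := H_rI n (-m)
    rw [add_sub_cancel_right, add_sub_cancel_right, show -(m + 1) + 1 = -m by ring] at h1
    rw [show -m - 1 = -(m + 1) by ring] at h2
    simp only [add_left_inj] at h
    linear_combination h - h1 + h2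

/-- Same induction as for `H_H`: the delta terms at (m-k, n) and (m, n+k) have the same condition
and cancel. -/
theorem Hs_H (m n : ℤ) (f : Sym) :
    Hs m (H n f) - T * Hs (m + 1) (H (n + 1) f) + H (n + 1) (Hs (m + 1) f) - T * H n (Hs m f) =
      if n = m then (1 - T) ^ 2 * f else 0 := by
  induction f using sym_induction generalizing m n with
  | one =>
    simp only [H_one, Hs_one]
    have h1 := Hs_qI (m + 1) (n + 1)
    have h2 := H_rI n (-m)
    rw [add_sub_cancel_right, add_sub_cancel_right, show -(m + 1) + 1 = -m by ring] at h1
    rw [show -m - 1 = -(m + 1) by ring] at h2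
    have h := Hs_qI_add m n
    split_ifs at h ⊢ <;> linear_combination (1 - T) * h - T * h1 - h2
  | smul a f hf =>
    have := congrArg (a • ·) (hf m n)
    simp only [map_smul, mul_smul_comm] at this ⊢
    rw [← smul_sub, ← smul_add, ← smul_sub]
    refine this.trans ?_
    split_ifs <;> simp
  | add f g hf hg =>
    simp only [map_add]
    have h1 := hf m n
    have h2 := hg m n
    split_ifs at h1 h2 ⊢ <;> linear_combination h1 + h2
  | mul i f hf =>
    simp only [H_X_mul, Hs_X_mul, map_sub, map_add]
    have h := hf m n
    have h1 := hf (m - (i + 1)) n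
    have h2 := hf m (n + (i + 1))
    rw [show m - (i + 1) + 1 = m + 1 - ((i : ℤ) + 1) by ring] at h1
    rw [show n + (i + 1) + 1 = n + 1 + ((i : ℤ) + 1) by ring] at h2
    have hiff : n = m - (i + 1) ↔ n + (i + 1) = m := by omega
    simp only [hiff] at h1
    split_ifs at h h1 h2 ⊢ <;> linear_combination (MvPolynomial.X i : Sym) * h + h1 - h2

/-- Each factor p_k of f lowers the index of `Hs` by k, so a bound for p_k f is the bound for f
increased by k. -/
theorem exists_Hs_H (f : Sym) : ∃ M : ℕ, ∀ m : ℤ, M ≤ m → ∀ n : ℤ,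
    Hs m (H n f) = if n = m then (1 - T) * f else 0 := by
  induction f using sym_induction with
  | one =>
    refine ⟨1, fun m hm n => ?_⟩
    have h := Hs_qI_of_pos (m.toNat - 1) n
    rw [show ((m.toNat - 1 : ℕ) : ℤ) + 1 = m by omega] at h
    rw [H_one, h, mul_one]
  | smul a f hf =>
    obtain ⟨M, hM⟩ := hf
    refine ⟨M, fun m hm n => ?_⟩
    rw [map_smul, map_smul, hM m hm n]
    split_ifs <;> simp
  | add f g hf hg =>
    obtain ⟨M, hM⟩ := hf
    obtain ⟨M', hM'⟩ := hg
    refine ⟨M + M', fun m hm n => ?_⟩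
    rw [map_add, map_add, hM m (by push_cast at hm; omega) n, hM' m (by push_cast at hm; omega) n]
    split_ifs <;> ring
  | mul i f hf =>
    obtain ⟨M, hM⟩ := hf
    refine ⟨M + (i + 1), fun m hm n => ?_⟩
    push_cast at hm
    rw [H_X_mul, map_sub, Hs_X_mul, hM m (by omega), hM (m - (i + 1)) (by omega),
      hM m (by omega) (n + (i + 1))]
    have hiff : n = m - (i + 1) ↔ n + (i + 1) = m := by omega
    simp only [hiff]
    split_ifs <;> ring

/-- Above m the terms of `Hs_H` with `Hs` applied directly to v drop out, leaving the recursion c_k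
= t c_{k+1} + (1-t)^2 δ. It fixes (1-t) δ, the value for large indices by `exists_Hs_H`, so this
value descends to index m+1; `Hs_H` at m then gives the claim. -/
theorem Hs_H_of_annihilated (m n : ℤ) (v : Sym) (hv : ∀ k : ℕ, Hs (m + (k + 1)) v = 0) :
    Hs m (H n v) = T * H n (Hs m v) + if n = m then (1 - T) * v else 0 := by
  obtain ⟨M, hM⟩ := exists_Hs_H v
  -- Here `d` bounds the distance to the range covered by `exists_Hs_H`.
  have key : ∀ d k : ℕ, (M : ℤ) ≤ m + (k + 1) + d → Hs (m + (k + 1)) (H (n + (k + 1)) v) =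
      if n = m then (1 - T) * v else 0 := by
    intro d
    induction d with
    | zero =>
      intro k hk
      rw [hM _ (by push_cast at hk; omega)]
      simp
    | succ d ih =>
      intro k hk
      have h := Hs_H (m + (k + 1)) (n + (k + 1)) v
      have h1 := ih (k + 1) (by push_cast at hk ⊢; omega)
      have h2 := hv (k + 1)
      push_cast at h1 h2
      rw [← add_assoc] at h2
      rw [← add_assoc m, ← add_assoc n] at h1
      rw [add_assoc m, add_assoc n] at h
      rw [add_assoc m] at h2
      rw [add_assoc m, add_assoc n] at h1
      rw [h1, h2, hv k, map_zero, map_zero] at h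
      simp only [add_left_inj] at h
      split_ifs at h ⊢ <;> linear_combination h
  have h := Hs_H m n v
  have h1 := key (M + (-m).toNat) 0 (by push_cast; omega)
  have h2 := hv 0
  simp only [Nat.cast_zero, zero_add] at h1 h2
  rw [h1, h2, map_zero] at h
  split_ifs at h ⊢ <;> linear_combination h

/-! ### The scalar product -/

/-- The scalar product with `⟨p_λ, p_μ⟩ = z_λ(t) δ_{λμ}`. -/
def form : Sym →ₗ[F] Sym →ₗ[F] F :=
  (MvPolynomial.basisMonomials ℕ F).constr F fun m => (zinv m)⁻¹ • MvPolynomial.lcoeff F m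

theorem form_monomial (m : ℕ →₀ ℕ) (g : Sym) :
    form (MvPolynomial.monomial m 1) g = (zinv m)⁻¹ * MvPolynomial.coeff m g := by
  have : (MvPolynomial.monomial m 1 : Sym) = MvPolynomial.basisMonomials ℕ F m := by simp
  rw [form, this, Module.Basis.constr_basis]
  rfl

theorem monomial_induction {P : Sym → Prop} (monomial : ∀ m, P (MvPolynomial.monomial m 1))
    (smul : ∀ (a : F) f, P f → P (a • f)) (add : ∀ f g, P f → P g → P (f + g)) (f : Sym) :
    P f := by
  induction f using MvPolynomial.induction_on' with
  | monomial m a =>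
    have := smul a _ (monomial m)
    rwa [MvPolynomial.smul_monomial, smul_eq_mul, mul_one] at this
  | add f g hf hg => exact add f g hf hg

theorem form_symm (f g : Sym) : form f g = form g f := by
  induction f using monomial_induction with
  | monomial m =>
    induction g using monomial_induction with
    | monomial m' =>
      rw [form_monomial, form_monomial, MvPolynomial.coeff_monomial, MvPolynomial.coeff_monomial]
      by_cases h : m = m'
      · subst h
        rfl
      · rw [if_neg h, if_neg (Ne.symm h), mul_zero, mul_zero]
    | smul a f hf => simp [hf]
    | add f g hf hg => simp [hf, hg]
  | smul a f hf => simp [hf]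
  | add f g hf hg => simp [hf, hg]

theorem form_X_mul (i : ℕ) (f g : Sym) :
    form (MvPolynomial.X i * f) g = form f (pp i g) := by
  induction f using monomial_induction with
  | monomial m =>
    rw [MvPolynomial.X, MvPolynomial.monomial_mul, mul_one, form_monomial, form_monomial, coeff_pp,
      add_comm]
    have h := zinv_add_single m i
    have h1 := zinv_ne_zero m
    have h2 := zinv_ne_zero (m + Finsupp.single i 1)
    have h3 := cc_ne_zero i
    field_simp
    linear_combination (-MvPolynomial.coeff (m + Finsupp.single i 1) g) * h
  | smul a f hf => rw [mul_smul_comm, map_smul, map_smul, LinearMap.smul_apply, hf]; rfl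
  | add f g hf hg => rw [mul_add, map_add, map_add, LinearMap.add_apply, hf, hg]; rfl

theorem form_one_one : form 1 1 = 1 := by
  have := form_monomial 0 1
  simpa [zinv] using this

theorem form_qI_one (k : ℤ) : form (qI k) 1 = if k = 0 then 1 else 0 := by
  rw [form_symm]
  have := form_monomial 0 (qI k)
  rw [coeff_qI, map_zero] at this
  simp only [MvPolynomial.monomial_zero', map_one] at this
  rw [this]
  simp [zinv, eq_comm]

theorem form_rI_one (k : ℤ) : form (rI k) 1 = if k = 0 then 1 else 0 := by
  split_ifs with h
  · rw [h, rI_zero, form_one_one]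
  rcases lt_or_ge k 0 with hk | hk
  · rw [rI_neg hk, map_zero, LinearMap.zero_apply]
  lift k to ℕ using hk
  have h1 := sum_qI_mul_rI k
  rw [if_neg (by simpa using h), Finset.sum_range_succ] at h1
  have h2 := congrArg (MvPolynomial.coeff 0) h1
  rw [MvPolynomial.coeff_add, MvPolynomial.coeff_sum, sub_self, qI_zero, one_mul,
    Finset.sum_eq_zero, zero_add] at h2
  · rw [form_symm]
    have := form_monomial 0 (rI k)
    rw [h2] at this
    simpa using this
  · intro j hj
    have := Finset.mem_range.mp hj
    rw [← MvPolynomial.constantCoeff_eq, map_mul, MvPolynomial.constantCoeff_eq, coeff_qI, map_zero,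
      if_neg (by simp; omega), zero_mul]

/-- The commutation of `H m` with p_k matches p_k^⊥ r_n = -r_{n-k}, which reduces everything to f =
1. -/
theorem form_H_one (m : ℤ) (f : Sym) : form (H m f) 1 = form f (rI (-m)) := by
  induction f using sym_induction generalizing m with
  | one =>
    rw [H_one, form_qI_one, form_symm, form_rI_one]
    simp
  | smul a f hf => simp [hf]
  | add f g hf hg => simp [hf, hg]
  | mul i f hf =>
    rw [H_X_mul, map_sub, LinearMap.sub_apply, form_X_mul, form_X_mul, hf, pp_rI]
    simp [sub_eq_add_neg, add_comm]

/-- `Hs m` is adjoint to `H m`. -/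
theorem form_H (m : ℤ) (f g : Sym) : form (H m f) g = form f (Hs m g) := by
  induction g using sym_induction generalizing m f with
  | one => rw [form_H_one, Hs_one]
  | smul a g hg => simp [hg]
  | add g h hg hh => simp [hg, hh]
  | mul i g hg =>
    -- The adjoint of the commutation rule `pp_H` is the rule `Hs_X_mul`.
    rw [form_symm, form_X_mul, form_symm, pp_H, map_add, LinearMap.add_apply, hg, hg, Hs_X_mul,
      map_add, form_symm f (MvPolynomial.X i * _), form_X_mul, form_symm (pp i f)]

/-! ### Hall–Littlewood functions as products of vertex operators -/

/-- The Hall–Littlewood function of an integer sequence. -/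
def QL (α : List ℤ) : Sym := α.foldr (fun m f => H m f) 1

@[simp] theorem QL_nil : QL [] = 1 := rfl

@[simp] theorem QL_cons (m : ℤ) (α : List ℤ) : QL (m :: α) = H m (QL α) := rfl

/-- By induction every `Hs` of index above m kills the tail, so `Hs_H_of_annihilated` applies. If
the head is m and the tail contains m c times, the scalar is t(1-t^c) + (1-t) = 1-t^{c+1}. -/
theorem Hs_QL (l : List ℤ) (hl : l.Pairwise (· ≥ ·)) (m : ℤ) (hm : 0 < m) (hlm : ∀ x ∈ l, x ≤ m) :
    Hs m (QL l) = (1 - t ^ l.count m) • QL l.tail := by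
  induction l generalizing m with
  | nil => simp [Hs_one, rI_neg (show -m < 0 by omega)]
  | cons n l ih =>
    rw [List.pairwise_cons] at hl
    have hnm : n ≤ m := hlm n (by simp)
    have hlm' : ∀ x ∈ l, x ≤ m := fun x hx => hlm x (List.mem_cons_of_mem _ hx)
    have hv : ∀ k : ℕ, Hs (m + (k + 1)) (QL l) = 0 := by
      intro k
      rw [ih hl.2 _ (by omega) (fun x hx => by have := hlm' x hx; omega), List.count_eq_zero_of_not_mem]
      · simp
      · intro h
        have := hlm' _ h
        omega
    rw [QL_cons, Hs_H_of_annihilated m n _ hv, ih hl.2 m hm hlm', List.tail_cons, map_smul]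
    by_cases h : n = m
    · subst h
      rw [if_pos rfl, List.count_cons_self]
      -- Either `l` begins with `n`, or it does not contain `n` and the scalar is 0.
      have h1 : (1 - t ^ l.count n) • H n (QL l.tail) = (1 - t ^ l.count n) • QL l := by
        cases l with
        | nil => simp
        | cons a l =>
          by_cases ha : a = n
          · subst ha
            rfl
          · rw [List.count_eq_zero_of_not_mem]
            · simp
            · intro hmem
              rcases List.mem_cons.mp hmem with rfl | hmem'
              · exact ha rfl
              · have h2 := (List.pairwise_cons.mp hl.2).1 _ hmem'
                have h3 := hl.1 a (by simp)
                exact ha (le_antisymm h3 h2)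
      rw [h1, ← t_smul, sub_mul, ← t_smul, one_mul, smul_smul]
      simp only [sub_smul, mul_sub, mul_one, one_smul, pow_succ']
      abel
    · have hc : (n :: l).count m = 0 := by
        rw [List.count_eq_zero]
        intro hmem
        rcases List.mem_cons.mp hmem with rfl | hmem'
        · exact h rfl
        · have := hl.1 _ hmem'
          omega
      have hc' : l.count m = 0 := by
        rw [List.count_cons_of_ne h] at hc
        exact hc
      rw [if_neg h, hc, hc']
      simp

/-- The norm of a Hall–Littlewood function, row by row. -/
def bL : List ℤ → F
  | [] => 1
  | m :: l => (1 - t ^ (m :: l).count m) * bL l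

/-- Moving the larger head across the form strips the other sequence of its head, with scalar 0
unless the heads agree. -/
theorem form_QL_cons {m m' : ℤ} {l l' : List ℤ} (hl : (m' :: l').Pairwise (· ≥ ·)) (hm : 0 < m)
    (hmm : m' ≤ m) (ih : form (QL l) (QL l') = if l = l' then bL l else 0) :
    form (QL (m :: l)) (QL (m' :: l')) = if m :: l = m' :: l' then bL (m :: l) else 0 := by
  have hle : ∀ x ∈ m' :: l', x ≤ m := by
    intro x hx
    rcases List.mem_cons.mp hx with rfl | hx'
    · exact hmm
    · exact ((List.pairwise_cons.mp hl).1 _ hx').trans hmm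
  rw [QL_cons, form_H, Hs_QL _ hl m hm hle, map_smul, List.tail_cons, ih, smul_eq_mul]
  by_cases h : m = m'
  · subst h
    by_cases h' : l = l'
    · subst h'
      simp [bL]
    · simp [h']
  · have hc : (m' :: l').count m = 0 := by
      rw [List.count_eq_zero]
      intro hmem
      rcases List.mem_cons.mp hmem with rfl | hmem'
      · exact h rfl
      · have := (List.pairwise_cons.mp hl).1 _ hmem'
        omega
    rw [hc]
    simp [h]

/-- Hall–Littlewood functions are orthogonal. -/
theorem form_QL (l l' : List ℤ) (hl : l.Pairwise (· ≥ ·)) (hl' : l'.Pairwise (· ≥ ·))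
    (hpos : ∀ x ∈ l, 0 < x) (hpos' : ∀ x ∈ l', 0 < x) :
    form (QL l) (QL l') = if l = l' then bL l else 0 := by
  have nilcons : ∀ (m : ℤ) (l : List ℤ), 0 < m → form (QL (m :: l)) (QL []) = 0 := by
    intro m l hm
    rw [QL_cons, form_H, QL_nil, Hs_one, rI_neg (by omega), map_zero]
  induction l generalizing l' with
  | nil =>
    cases l' with
    | nil => simpa [bL] using form_one_one
    | cons m l' => rw [form_symm, nilcons _ _ (hpos' m (by simp)), if_neg (by simp)]
  | cons m l ih =>
    cases l' with
    | nil => rw [nilcons _ _ (hpos m (by simp)), if_neg (by simp)]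
    | cons m' l' =>
      have ih' := ih l' (List.pairwise_cons.mp hl).2 (List.pairwise_cons.mp hl').2
        (fun x hx => hpos x (List.mem_cons_of_mem _ hx))
        (fun x hx => hpos' x (List.mem_cons_of_mem _ hx))
      rcases le_total m' m with h | h
      · exact form_QL_cons hl' (hpos m (by simp)) h ih'
      · have ih'' : form (QL l') (QL l) = if l' = l then bL l' else 0 := by
          rw [form_symm, ih']
          by_cases he : l = l'
          · subst he
            rfl
          · rw [if_neg he, if_neg (Ne.symm he)]
        rw [form_symm, form_QL_cons hl (hpos' m' (by simp)) h ih'']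
        by_cases he : m :: l = m' :: l'
        · rw [he]
        · rw [if_neg he, if_neg (Ne.symm he)]

/-- A row contributes 1-t^c, with c the number of its copies from that row on; over equal rows c
runs from 1 to the multiplicity. -/
theorem bL_map_cast (l : List ℕ) (s : Finset ℕ) (hs : ∀ x ∈ l, x ∈ s) :
    bL (l.map (Nat.cast : ℕ → ℤ)) = ∏ i ∈ s, ∏ k ∈ Finset.Icc 1 (l.count i), (1 - t ^ k) := by
  induction l with
  | nil => simp [bL]
  | cons m l ih =>
    have hc : ((m :: l).map (Nat.cast : ℕ → ℤ)).count (m : ℤ) = l.count m + 1 := by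
      rw [List.count_map_of_injective _ _ Nat.cast_injective, List.count_cons_self]
    have h : ∀ i ∈ s, ∏ k ∈ Finset.Icc 1 ((m :: l).count i), (1 - t ^ k) =
        (∏ k ∈ Finset.Icc 1 (l.count i), (1 - t ^ k)) *
          if i = m then 1 - t ^ (l.count m + 1) else 1 := by
      intro i _
      by_cases hi : i = m
      · subst hi
        rw [List.count_cons_self, Finset.prod_Icc_succ_top (by omega), if_pos rfl]
      · rw [List.count_cons_of_ne (Ne.symm hi), if_neg hi, mul_one]
    rw [Finset.prod_congr rfl h, Finset.prod_mul_distrib,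
      ← ih fun x hx => hs x (List.mem_cons_of_mem _ hx), Finset.prod_ite_eq', if_pos (hs m (by simp)),
      mul_comm, List.map_cons, bL, ← List.map_cons (f := (Nat.cast : ℕ → ℤ)), hc]

/-! ### Homogeneity -/

/-- The homogeneous symmetric functions of degree `k`. -/
def homog (k : ℤ) : Submodule F Sym where
  carrier := {f | ∀ m, MvPolynomial.coeff m f ≠ 0 → (wt m : ℤ) = k}
  zero_mem' := by simp
  add_mem' := by
    intro f g hf hg m hm
    rw [MvPolynomial.coeff_add] at hm
    by_cases h : MvPolynomial.coeff m f = 0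
    · exact hg m (by simpa [h] using hm)
    · exact hf m h
  smul_mem' := by
    intro a f hf m hm
    rw [MvPolynomial.coeff_smul] at hm
    exact hf m (right_ne_zero_of_smul hm)

theorem qI_mem_homog (k : ℤ) : qI k ∈ homog k := by
  intro m hm
  rw [coeff_qI] at hm
  by_contra h
  exact hm (if_neg h)

theorem X_mul_mem_homog (i : ℕ) {k : ℤ} {f : Sym} (hf : f ∈ homog k) :
    MvPolynomial.X i * f ∈ homog (k + (i + 1)) := by
  intro m hm
  rw [MvPolynomial.coeff_X_mul'] at hm
  split_ifs at hm with hi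
  · have h := hf _ hm
    have hle : Finsupp.single i 1 ≤ m := by
      rw [Finsupp.single_le_iff]
      exact Nat.one_le_iff_ne_zero.mpr (Finsupp.mem_support_iff.mp hi)
    rw [← tsub_add_cancel_of_le hle, map_add, wt_single, ← h]
    push_cast
    ring
  · exact absurd rfl hm

theorem H_prod_mem_homog (s : Multiset ℕ) (m : ℤ) :
    H m (s.map (MvPolynomial.X : ℕ → Sym)).prod ∈ homog (m + ((s.map (· + 1)).sum : ℕ)) := by
  induction s using Multiset.induction_on generalizing m with
  | empty => simpa [H_one] using qI_mem_homog m
  | cons a s ih =>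
    rw [Multiset.map_cons, Multiset.map_cons, Multiset.prod_cons, H_X_mul]
    refine Submodule.sub_mem _ ?_ ?_
    · convert X_mul_mem_homog a (ih m) using 2
      simp
      ring
    · convert ih (m + (a + 1)) using 2
      simp
      ring

theorem H_mem_homog (m : ℤ) {k : ℤ} {f : Sym} (hf : f ∈ homog k) : H m f ∈ homog (m + k) := by
  rw [MvPolynomial.as_sum f, map_sum]
  refine Submodule.sum_mem _ fun s hs => ?_
  have h := hf s (MvPolynomial.mem_support_iff.mp hs)
  have h1 : MvPolynomial.monomial s (MvPolynomial.coeff s f) =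
      MvPolynomial.coeff s f • ((Finsupp.toMultiset s).map (MvPolynomial.X : ℕ → Sym)).prod := by
    rw [prod_map_X, MvPolynomial.smul_monomial, Finsupp.toMultiset_toFinsupp, smul_eq_mul, mul_one]
  rw [h1, map_smul]
  refine Submodule.smul_mem _ _ ?_
  have h2 := H_prod_mem_homog (Finsupp.toMultiset s) m
  rwa [← wt_toFinsupp, Finsupp.toMultiset_toFinsupp, h] at h2

/-- Homogeneity confines Q_λ to the span of the p_μ with μ ⊢ n, so that the transition matrices
below are square. -/
theorem QL_mem_homog (α : List ℤ) : QL α ∈ homog α.sum := by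
  induction α with
  | nil =>
    have := qI_mem_homog 0
    rwa [qI_zero] at this
  | cons m α ih =>
    rw [List.sum_cons]
    exact H_mem_homog m ih

theorem eq_sum_powS {n : ℕ} {f : Sym} (hf : f ∈ homog n) :
    f = ∑ mu : n.Partition, MvPolynomial.coeff (expo mu) f • powS mu := by
  ext m
  simp only [MvPolynomial.coeff_sum, MvPolynomial.coeff_smul, powS_eq, MvPolynomial.coeff_monomial,
    smul_eq_mul, mul_ite, mul_one, mul_zero]
  by_cases h : wt m = n
  · subst h
    rw [Finset.sum_eq_single (ofExpo m)]
    · simp [expo_ofExpo]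
    · intro c _ hc
      exact if_neg fun hcm => hc (expo_injective (hcm.trans (expo_ofExpo m).symm))
    · simp
  · have h0 : MvPolynomial.coeff m f = 0 := by
      by_contra h0
      exact h (by exact_mod_cast hf m h0)
    rw [h0, Finset.sum_eq_zero]
    intro c _
    rw [if_neg]
    rintro rfl
    exact h (wt_expo c)

/-! ### The dual bases -/

/-- The rows of a partition as integers. -/
def rowsZ {n : ℕ} (lam : n.Partition) : List ℤ := (rows lam).map (Nat.cast : ℕ → ℤ)

theorem coe_rows {n : ℕ} (lam : n.Partition) : (rows lam : Multiset ℕ) = lam.parts :=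
  Multiset.sort_eq _ _

theorem mem_rows {n : ℕ} {lam : n.Partition} {x : ℕ} : x ∈ rows lam ↔ x ∈ lam.parts := by
  rw [← coe_rows, Multiset.mem_coe]

theorem rows_pairwise {n : ℕ} (lam : n.Partition) : (rows lam).Pairwise (· ≥ ·) :=
  Multiset.pairwise_sort _ _

theorem rowsZ_pairwise {n : ℕ} (lam : n.Partition) : (rowsZ lam).Pairwise (· ≥ ·) := by
  rw [rowsZ, List.pairwise_map]
  exact (rows_pairwise lam).imp fun h => by exact_mod_cast h

theorem rowsZ_pos {n : ℕ} (lam : n.Partition) : ∀ x ∈ rowsZ lam, 0 < x := by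
  intro x hx
  obtain ⟨y, hy, rfl⟩ := List.mem_map.mp hx
  exact_mod_cast lam.parts_pos (mem_rows.mp hy)

theorem rowsZ_sum {n : ℕ} (lam : n.Partition) : (rowsZ lam).sum = n := by
  rw [rowsZ]
  have h : (rows lam).sum = n := by
    rw [← Multiset.sum_coe, coe_rows, lam.parts_sum]
  rw [← Nat.cast_list_sum, h]

theorem rowsZ_injective {n : ℕ} : Function.Injective (rowsZ (n := n)) := by
  intro lam mu h
  have h1 : rows lam = rows mu := List.map_injective_iff.mpr Nat.cast_injective h
  ext1
  rw [← coe_rows, h1, coe_rows]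

theorem b_eq {n : ℕ} (lam : n.Partition) : b lam = bL (rowsZ lam) := by
  rw [rowsZ, bL_map_cast _ lam.parts.toFinset fun x hx => by
    rw [Multiset.mem_toFinset]; exact mem_rows.mp hx, b]
  refine Finset.prod_congr rfl fun i _ => ?_
  rw [← coe_rows, Multiset.coe_count]

theorem b_ne_zero {n : ℕ} (lam : n.Partition) : b lam ≠ 0 := by
  refine Finset.prod_ne_zero_iff.mpr fun i _ => Finset.prod_ne_zero_iff.mpr fun k hk => ?_
  have := (Finset.mem_Icc.mp hk).1
  exact one_sub_t_pow_ne_zero (by omega)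

/-- The polynomial model of `P_λ`. -/
def PS {n : ℕ} (lam : n.Partition) : Sym := (b lam)⁻¹ • QL (rowsZ lam)

theorem form_PS {n : ℕ} (lam mu : n.Partition) :
    form (PS lam) (QL (rowsZ mu)) = if lam = mu then 1 else 0 := by
  rw [PS, map_smul, LinearMap.smul_apply, form_QL _ _ (rowsZ_pairwise _) (rowsZ_pairwise _)
    (rowsZ_pos _) (rowsZ_pos _), ← b_eq]
  simp only [rowsZ_injective.eq_iff]
  split_ifs
  · exact inv_mul_cancel₀ (b_ne_zero lam)
  · exact smul_zero _

/-- The matrix expressing the `P_λ` through power sums. -/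
def toPow (n : ℕ) : Matrix n.Partition n.Partition F :=
  Matrix.of fun lam mu => MvPolynomial.coeff (expo mu) (PS lam)

/-- The matrix `⟨p_μ, Q_λ⟩`. -/
def fromPow (n : ℕ) : Matrix n.Partition n.Partition F :=
  Matrix.of fun mu lam => form (powS mu) (QL (rowsZ lam))

theorem PS_eq_sum {n : ℕ} (lam : n.Partition) : PS lam = ∑ mu, toPow n lam mu • powS mu := by
  refine eq_sum_powS (Submodule.smul_mem _ _ ?_)
  have := QL_mem_homog (rowsZ lam)
  rwa [rowsZ_sum] at this

theorem toPow_mul_fromPow (n : ℕ) : toPow n * fromPow n = 1 := by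
  ext lam nu
  rw [Matrix.mul_apply, Matrix.one_apply, ← form_PS, PS_eq_sum lam, map_sum, LinearMap.sum_apply]
  refine Finset.sum_congr rfl fun mu _ => ?_
  rw [map_smul, LinearMap.smul_apply]
  rfl

theorem powS_eq_sum {n : ℕ} (mu : n.Partition) :
    powS mu = ∑ lam : n.Partition, form (powS mu) (QL (rowsZ lam)) • PS lam := by
  -- For square matrices a left inverse is a right inverse, so duality already yields the expansion.
  have h := mul_eq_one_comm.mp (toPow_mul_fromPow n)
  simp only [PS_eq_sum, Finset.smul_sum, smul_smul]
  rw [Finset.sum_comm]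
  simp only [← Finset.sum_smul]
  have h1 : ∀ nu, ∑ lam : n.Partition, form (powS mu) (QL (rowsZ lam)) * toPow n lam nu =
      if mu = nu then 1 else 0 := by
    intro nu
    rw [← Matrix.one_apply, ← h, Matrix.mul_apply]
    rfl
  simp [h1]

/-! ### Linear independence of the power sum products -/

theorem card_support_add_single (m : ℕ →₀ ℕ) (i k : ℕ) (hk : 0 < k) :
    (m + Finsupp.single i k).support = insert i m.support := by
  ext j
  by_cases h : j = i
  · subst h
    simp
    omega
  · simp [h]

/-- Coefficients of p_μ are natural numbers, so nothing cancels. Its monomials involve at most l(μ)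
variables, and those with exactly l(μ) have exponent multiset μ. -/
theorem powerSum_prod_coeff (s : Multiset ℕ) (hs : ∀ x ∈ s, 0 < x) :
    ∃ N : (ℕ →₀ ℕ) → ℕ,
      (∀ m, MvPowerSeries.coeff m ((s.map powerSum).prod) = (N m : F)) ∧
      (∀ m, N m ≠ 0 → m.support.card ≤ s.card ∧
        (m.support.card = s.card → m.support.val.map m = s)) ∧
      ∃ m, N m ≠ 0 ∧ m.support.card = s.card := by
  classical
  induction s using Multiset.induction_on with
  | empty =>
    refine ⟨fun m => if m = 0 then 1 else 0, fun m => ?_, fun m hm => ?_, 0, by simp, by simp⟩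
    · simp [MvPowerSeries.coeff_one]
    · have : m = 0 := by
        by_contra h
        exact hm (if_neg h)
      subst this
      simp
  | cons k s ih =>
    obtain ⟨N, hN, hN1, m0, hm0, hm0c⟩ := ih fun x hx => hs x (Multiset.mem_cons_of_mem hx)
    have hk : 0 < k := hs k (Multiset.mem_cons_self k s)
    refine ⟨fun m => ∑ p ∈ Finset.HasAntidiagonal.antidiagonal m,
      (if ∃ i, p.1 = Finsupp.single i k then 1 else 0) * N p.2, fun m => ?_, fun m hm => ?_, ?_⟩
    · rw [Multiset.map_cons, Multiset.prod_cons, MvPowerSeries.coeff_mul]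
      push_cast
      refine Finset.sum_congr rfl fun p _ => ?_
      rw [hN]
      congr 1
    · obtain ⟨p, hp, hp0⟩ := Finset.exists_ne_zero_of_sum_ne_zero hm
      have hp1 := right_ne_zero_of_mul hp0
      have hp2 := left_ne_zero_of_mul hp0
      obtain ⟨i, hi⟩ : ∃ i, p.1 = Finsupp.single i k := by
        by_contra h
        exact hp2 (if_neg h)
      have hm' : m = p.2 + Finsupp.single i k := by
        rw [← Finset.HasAntidiagonal.mem_antidiagonal.mp hp, hi, add_comm]
      obtain ⟨h1, h2⟩ := hN1 p.2 hp1
      rw [hm', card_support_add_single _ _ _ hk, Multiset.card_cons]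
      by_cases his : i ∈ p.2.support
      · rw [Finset.insert_eq_of_mem his]
        exact ⟨by omega, fun h => by omega⟩
      · rw [Finset.card_insert_of_notMem his]
        refine ⟨by omega, fun h => ?_⟩
        rw [Finset.insert_val_of_notMem his, Multiset.map_cons, ← h2 (by omega)]
        have hi0 : p.2 i = 0 := Finsupp.notMem_support_iff.mp his
        congr 1
        · simp [hi0]
        · refine Multiset.map_congr rfl fun j hj => ?_
          have : i ≠ j := by
            rintro rfl
            exact his hj
          simp [this]
    -- A variable not yet used makes the number of variables grow by one.
    · obtain ⟨i, hi⟩ := Infinite.exists_notMem_finset m0.support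
      refine ⟨m0 + Finsupp.single i k, ?_, ?_⟩
      · intro h
        have h1 := Finset.sum_eq_zero_iff.mp h (Finsupp.single i k, m0)
          (Finset.HasAntidiagonal.mem_antidiagonal.mpr (add_comm _ _))
        rw [if_pos ⟨i, rfl⟩, one_mul] at h1
        exact hm0 h1
      · rw [card_support_add_single _ _ _ hk, Finset.card_insert_of_notMem hi, hm0c,
          Multiset.card_cons]

theorem powerSumP_linearIndependent (n : ℕ) :
    LinearIndependent F (powerSumP : n.Partition → V) := by
  classical
  rw [Fintype.linearIndependent_iff]
  intro c hc
  by_contra hne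
  push Not at hne
  -- For λ of maximal length in the relation, a monomial with exponents λ in distinct variables
  -- occurs in no other p_μ of the relation.
  obtain ⟨lam, hlam, hmax⟩ := Finset.exists_max_image
    (Finset.univ.filter fun lam : n.Partition => c lam ≠ 0) (fun lam => lam.parts.card)
    (by obtain ⟨i, hi⟩ := hne; exact ⟨i, by simp [hi]⟩)
  rw [Finset.mem_filter] at hlam
  choose N hN hN1 hN2 using fun mu : n.Partition =>
    powerSum_prod_coeff mu.parts fun x hx => mu.parts_pos hx
  obtain ⟨m, hm, hmc⟩ := hN2 lam
  have h := congrArg (MvPowerSeries.coeff m) hc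
  rw [map_sum, Finset.sum_eq_single lam, map_zero, map_smul, powerSumP, hN, smul_eq_mul] at h
  · rcases mul_eq_zero.mp h with h | h
    · exact hlam.2 h
    · exact hm (by exact_mod_cast h)
  · intro mu _ hmu
    rw [map_smul, powerSumP, hN, smul_eq_mul, mul_eq_zero]
    by_contra h0
    push Not at h0
    have hNm : N mu m ≠ 0 := by exact_mod_cast h0.2
    obtain ⟨h1, h2⟩ := hN1 mu m hNm
    have h3 := hmax mu (by simp [h0.1])
    apply hmu
    ext1
    rw [← h2 (by omega), (hN1 lam m hm).2 hmc]
  · simp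

/-! ### Raising operators and vertex operators -/

/-- The pairs `i < j` of indices. -/
abbrev PairIdx (n : ℕ) : Type := {e : Fin n × Fin n // e.1 < e.2}

/-- The index vector obtained by applying the raising operators `∏ R_e ^ (M e)` to `β`. -/
def raised {n : ℕ} (β : Fin n → ℤ) (M : PairIdx n → ℕ) (i : Fin n) : ℤ :=
  β i + (∑ e with e.1.1 = i, (M e : ℤ)) - (∑ e with e.1.2 = i, (M e : ℤ))

/-- The contribution of `∏ R_e ^ (M e)`. -/
def raiseTerm {n : ℕ} (β : Fin n → ℤ) (M : PairIdx n → ℕ) : Sym :=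
  (∏ e, raiseCoeff (M e)) • ∏ i, qI (raised β M i)

/-- A pair of indices either involves the first index or is a pair of later ones. -/
def pairEquiv (n : ℕ) : Fin n ⊕ PairIdx n ≃ PairIdx (n + 1) :=
  Equiv.ofBijective
    (Sum.elim (fun j => ⟨(0, j.succ), Fin.succ_pos j⟩)
      (fun e => ⟨(e.1.1.succ, e.1.2.succ), Fin.succ_lt_succ_iff.mpr e.2⟩)) <| by
    constructor
    · rintro (j | ⟨⟨a, c⟩, h⟩) (j' | ⟨⟨a', c'⟩, h'⟩) he
      · simpa using he
      · simp [(Fin.succ_ne_zero a').symm] at he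
      · simp at he
      · simpa using he
    · rintro ⟨⟨a, c⟩, h⟩
      have hc : c ≠ 0 := (Fin.zero_le a |>.trans_lt h).ne'
      obtain ⟨c, rfl⟩ := Fin.exists_succ_eq.mpr hc
      rcases Fin.eq_zero_or_eq_succ a with rfl | ⟨a, rfl⟩
      · exact ⟨Sum.inl c, rfl⟩
      · exact ⟨Sum.inr ⟨(a, c), Fin.succ_lt_succ_iff.mp h⟩, rfl⟩

/-- Exponents of raising operators, split according to `pairEquiv`. -/
def splitEquiv (n : ℕ) : (PairIdx n → ℕ) × (Fin n → ℕ) ≃ (PairIdx (n + 1) → ℕ) :=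
  (Equiv.prodComm _ _).trans
    ((Equiv.sumArrowEquivProdArrow _ _ ℕ).symm.trans ((pairEquiv n).arrowCongr (Equiv.refl ℕ)))

theorem pairEquiv_inl {n : ℕ} (j : Fin n) : (pairEquiv n (Sum.inl j)).1 = (0, j.succ) := rfl

theorem pairEquiv_inr {n : ℕ} (e : PairIdx n) :
    (pairEquiv n (Sum.inr e)).1 = (e.1.1.succ, e.1.2.succ) := rfl

theorem splitEquiv_pairEquiv {n : ℕ} (p : (PairIdx n → ℕ) × (Fin n → ℕ)) (x : Fin n ⊕ PairIdx n) :
    splitEquiv n p (pairEquiv n x) = Sum.elim p.2 p.1 x := by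
  simp [splitEquiv, Equiv.arrowCongr, Equiv.sumArrowEquivProdArrow]

theorem sum_pairIdx {n : ℕ} (g : PairIdx (n + 1) → ℤ) :
    ∑ e, g e = ∑ j, g (pairEquiv n (Sum.inl j)) + ∑ e, g (pairEquiv n (Sum.inr e)) := by
  rw [← Equiv.sum_comp (pairEquiv n), Fintype.sum_sum_type]

theorem raised_zero {n : ℕ} (β : Fin (n + 1) → ℤ) (p : (PairIdx n → ℕ) × (Fin n → ℕ)) :
    raised β (splitEquiv n p) 0 = β 0 + (∑ j, p.2 j : ℕ) := by
  simp only [raised, Finset.sum_filter]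
  rw [sum_pairIdx, sum_pairIdx]
  simp only [splitEquiv_pairEquiv, Sum.elim_inl, Sum.elim_inr]
  simp [pairEquiv_inl, pairEquiv_inr]

theorem raised_succ {n : ℕ} (β : Fin (n + 1) → ℤ) (p : (PairIdx n → ℕ) × (Fin n → ℕ)) (i : Fin n) :
    raised β (splitEquiv n p) i.succ = raised (fun i => β i.succ) p.1 i - p.2 i := by
  simp only [raised, Finset.sum_filter]
  rw [sum_pairIdx, sum_pairIdx]
  simp only [splitEquiv_pairEquiv, Sum.elim_inl, Sum.elim_inr]
  simp [pairEquiv_inl, pairEquiv_inr, (Fin.succ_ne_zero i).symm]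
  ring

theorem prod_raiseCoeff {n : ℕ} (p : (PairIdx n → ℕ) × (Fin n → ℕ)) :
    ∏ e, raiseCoeff (splitEquiv n p e) =
      (∏ e, raiseCoeff (p.1 e)) * ∏ j, raiseCoeff (p.2 j) := by
  rw [← Equiv.prod_comp (pairEquiv n), Fintype.prod_sum_type, mul_comm]
  simp only [splitEquiv_pairEquiv, Sum.elim_inl, Sum.elim_inr]

theorem raiseCoeff_succ (a : ℕ) :
    raiseCoeff (a + 1) = t * raiseCoeff a - if a = 0 then 1 else 0 := by
  cases a with
  | zero => simp [raiseCoeff]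
  | succ a =>
    simp only [raiseCoeff, pow_succ, Nat.succ_ne_zero, if_false]
    ring

theorem shift_neg_one_qI_natCast (n : ℕ) : shift (-1) (qI n) =
    ∑ a ∈ Finset.range (n + 1), Polynomial.monomial a (raiseCoeff a • qI (n - a)) := by
  induction n with
  | zero =>
    rw [Nat.cast_zero, qI_zero]
    simp [raiseCoeff, qI_zero]
  | succ n ih =>
    rw [shift_neg_one_qI, show ((n + 1 : ℕ) : ℤ) - 1 = n by push_cast; ring, ih,
      Finset.sum_range_succ' _ (n + 1), Finset.mul_sum]
    have h : ∀ a ∈ Finset.range (n + 1), Polynomial.monomial (a + 1)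
        (raiseCoeff (a + 1) • qI ((n + 1 : ℕ) - (a + 1 : ℕ))) =
        (t • (Polynomial.X : Polynomial Sym)) *
          Polynomial.monomial a (raiseCoeff a • qI (n - a)) -
        if a = 0 then Polynomial.X * Polynomial.C (qI n) else 0 := by
      intro a _
      rw [raiseCoeff_succ, sub_smul, map_sub, smul_mul_assoc, Polynomial.X_mul_monomial,
        Polynomial.smul_monomial, smul_smul,
        show ((n + 1 : ℕ) : ℤ) - (a + 1 : ℕ) = n - a by push_cast; ring]
      congr 1
      split_ifs with h
      · subst h
        rw [one_smul, ← Polynomial.C_mul_X_pow_eq_monomial, zero_add, pow_one, Nat.cast_zero,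
          sub_zero, mul_comm]
      · simp
    rw [Finset.sum_congr rfl h, Finset.sum_sub_distrib]
    simp [raiseCoeff]
    ring

theorem shift_neg_one_qI_eq_sum (k : ℤ) : shift (-1) (qI k) =
    ∑ a ∈ Finset.range (k.toNat + 1), Polynomial.monomial a (raiseCoeff a • qI (k - a)) := by
  rcases lt_or_ge k 0 with hk | hk
  · rw [qI_neg hk, map_zero, Finset.sum_eq_zero]
    intro a _
    rw [qI_neg (by omega), smul_zero, map_zero]
  · lift k to ℕ using hk
    exact shift_neg_one_qI_natCast k

theorem prod_monomial {n : ℕ} (c : Fin n → ℕ) (f : Fin n → Sym) :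
    ∏ j, Polynomial.monomial (c j) (f j) = Polynomial.monomial (∑ j, c j) (∏ j, f j) := by
  simp only [← Polynomial.C_mul_X_pow_eq_monomial, Finset.prod_mul_distrib, map_prod,
    Finset.prod_pow_eq_pow_sum]

/-- The shift is multiplicative and sends q_k to Σ_a `raiseCoeff a` q_{k-a} X^a; the total power of
X is added to the first index. -/
theorem H_prod_qI {n : ℕ} (m : ℤ) (γ : Fin n → ℤ) : H m (∏ j, qI (γ j)) =
    ∑ᶠ c : Fin n → ℕ, (∏ j, raiseCoeff (c j)) •
      (qI (m + (∑ j, c j : ℕ)) * ∏ j, qI (γ j - c j)) := by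
  rw [finsum_eq_sum_of_support_subset (s := Fintype.piFinset fun j =>
    Finset.range ((γ j).toNat + 1))]
  · rw [H, vert_apply, map_prod]
    simp only [shift_neg_one_qI_eq_sum]
    rw [Finset.prod_univ_sum, map_sum]
    refine Finset.sum_congr rfl fun c _ => ?_
    rw [prod_monomial, ev_monomial, Finset.prod_smul, smul_mul_assoc, mul_comm (qI _)]
  · intro c hc
    rw [Finset.mem_coe, Fintype.mem_piFinset]
    intro j
    rw [Finset.mem_range]
    by_contra hj
    refine hc ?_
    have h0 : ∏ j, qI (γ j - c j) = 0 :=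
      Finset.prod_eq_zero (Finset.mem_univ j) (qI_neg (by omega))
    simp only [h0, mul_zero, smul_zero]

theorem raiseTerm_support {n : ℕ} (β : Fin n → ℤ) :
    Function.support (raiseTerm β) ⊆ {M | ∀ i, 0 ≤ raised β M i} := by
  intro M hM i
  by_contra hi
  refine hM ?_
  rw [raiseTerm, Finset.prod_eq_zero (Finset.mem_univ i) (qI_neg (by omega)), smul_zero]

/-- Raising from the first index only lowers later ones, so the exponents on later pairs already
satisfy the condition; they then bound the exponents on the pairs (0, j). -/
theorem finite_raised {n : ℕ} (β : Fin n → ℤ) : {M | ∀ i, 0 ≤ raised β M i}.Finite := by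
  induction n with
  | zero => exact Set.toFinite _
  | succ n ih =>
    refine ((ih fun i => β i.succ).biUnion fun M _ =>
      (Set.finite_Iic fun j => (raised (fun i => β i.succ) M j).toNat).image
        fun c => splitEquiv n (M, c)).subset ?_
    intro M hM
    obtain ⟨p, rfl⟩ := (splitEquiv n).surjective M
    have h1 : ∀ j, (p.2 j : ℤ) ≤ raised (fun i => β i.succ) p.1 j := by
      intro j
      have := hM j.succ
      rw [raised_succ] at this
      omega
    refine Set.mem_biUnion (x := p.1) (fun i => ?_) ⟨p.2, fun j => ?_, rfl⟩
    · have := h1 i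
      omega
    · have := h1 j
      show p.2 j ≤ (raised (fun i => β i.succ) p.1 j).toNat
      omega

/-- The raising operators on pairs (0, j) are what the first vertex operator does by `H_prod_qI`;
those on later pairs are handled by induction. -/
theorem finsum_raiseTerm {n : ℕ} (β : Fin n → ℤ) :
    ∑ᶠ M, raiseTerm β M = QL (List.ofFn β) := by
  induction n with
  | zero =>
    rw [finsum_unique]
    simp [raiseTerm]
  | succ n ih =>
    have hfin : ∀ {k} (β : Fin k → ℤ), (Function.support (raiseTerm β)).Finite := fun β =>
      (finite_raised β).subset (raiseTerm_support β)
    rw [List.ofFn_succ, QL_cons, ← ih,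
      ← finsum_comp_equiv (splitEquiv n), finsum_curry]
    · rw [map_finsum (H (β 0)) (hfin _)]
      refine finsum_congr fun M => ?_
      rw [raiseTerm, map_smul, H_prod_qI, smul_finsum]
      refine finsum_congr fun c => ?_
      rw [raiseTerm, prod_raiseCoeff, Fin.prod_univ_succ, raised_zero, smul_smul]
      simp only [raised_succ]
    · exact (hfin β).preimage (splitEquiv n).injective.injOn

/-! ### Transfer to power series and the Green polynomials as scalar products -/

/-- The map to formal power series. -/
def toV : Sym →ₐ[F] V := MvPolynomial.aeval fun i => powerSum (i + 1)

theorem toV_powS {n : ℕ} (mu : n.Partition) : toV (powS mu) = powerSumP mu := by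
  rw [powS, powerSumP, map_multiset_prod, Multiset.map_map]
  congr 1
  refine Multiset.map_congr rfl fun x hx => ?_
  have := mu.parts_pos hx
  simp only [Function.comp_apply, pS, toV, MvPolynomial.aeval_X]
  congr 1
  omega

theorem toV_qI (k : ℤ) : toV (qI k) = qInt k := by
  unfold qI qInt
  split_ifs
  · exact map_zero _
  · simp only [qS, q, map_sum, map_smul, toV_powS]

theorem toV_QL {n : ℕ} (lam : n.Partition) : toV (QL (rowsZ lam)) = hlQ lam := by
  have h : rowsZ lam = List.ofFn fun i => ((rows lam).get i : ℤ) := by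
    rw [rowsZ]
    conv_lhs => rw [← List.ofFn_get (rows lam), List.map_ofFn]
    rfl
  rw [h, ← finsum_raiseTerm, map_finsum toV ((finite_raised _).subset (raiseTerm_support _)), hlQ]
  refine finsum_congr fun M => ?_
  rw [raiseTerm, map_smul, map_prod]
  simp only [toV_qI]
  rfl

theorem toV_PS {n : ℕ} (lam : n.Partition) : toV (PS lam) = hlP lam := by
  rw [PS, map_smul, toV_QL, hlP]

theorem isExpansion_form {n : ℕ} (mu : n.Partition) :
    IsExpansion mu fun lam => form (powS mu) (QL (rowsZ lam)) := by
  have h := congrArg toV (powS_eq_sum mu)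
  rw [IsExpansion]
  simpa only [map_sum, map_smul, toV_powS, toV_PS] using h

/-- Independence of the p_ν turns an expansion into the vector equation c · `toPow` = e_μ, which
`fromPow` inverts. -/
theorem isExpansion_unique {n : ℕ} (mu : n.Partition) (c : n.Partition → F)
    (hc : IsExpansion mu c) : c = fun lam => form (powS mu) (QL (rowsZ lam)) := by
  have hP : ∀ lam : n.Partition, hlP lam = ∑ nu, toPow n lam nu • powerSumP nu := by
    intro lam
    have h := congrArg toV (PS_eq_sum lam)
    simpa only [map_sum, map_smul, toV_powS, toV_PS] using h
  have h1 : ∑ nu, (Matrix.vecMul c (toPow n) nu - if nu = mu then 1 else 0) • powerSumP nu =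
      (0 : V) := by
    simp only [sub_smul, Finset.sum_sub_distrib, ite_smul, one_smul, zero_smul,
      Finset.sum_ite_eq', Finset.mem_univ, if_true]
    rw [sub_eq_zero, hc]
    simp only [hP, Finset.smul_sum, smul_smul, Matrix.vecMul, dotProduct, Finset.sum_smul]
    exact Finset.sum_comm
  have h2 := Fintype.linearIndependent_iff.mp (powerSumP_linearIndependent n) _ h1
  have h3 : Matrix.vecMul c (toPow n) = Pi.single mu 1 := by
    ext nu
    rw [sub_eq_zero.mp (h2 nu), Pi.single_apply]
  have h4 := congrArg (fun v => Matrix.vecMul v (fromPow n)) h3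
  simp only [Matrix.vecMul_vecMul, toPow_mul_fromPow, Matrix.vecMul_one,
    Matrix.single_one_vecMul] at h4
  rw [h4]
  rfl

theorem green_eq {n : ℕ} (lam mu : n.Partition) :
    green lam mu = form (powS mu) (QL (rowsZ lam)) := by
  have h : IsExpansion mu (Classical.epsilon (IsExpansion mu)) :=
    Classical.epsilon_spec ⟨_, isExpansion_form mu⟩
  rw [green, isExpansion_unique mu _ h]

/-! ### Straightening -/

theorem pp_QL (i : ℕ) (α : List ℤ) : pp i (QL α) =
    ∑ j ∈ Finset.range α.length, QL (α.modify j fun x => x - ((i : ℤ) + 1)) := by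
  induction α with
  | nil => simp
  | cons m α ih =>
    rw [QL_cons, pp_H, ih, List.length_cons, Finset.sum_range_succ', map_sum]
    rfl

/-- The coefficient of the straightening relation for two rows with difference `d`. -/
def gapCoeff (d : ℤ) (a : ℕ) : F :=
  if a = 0 then t
  else if (a : ℤ) < d / 2 then t ^ (a + 1) - t ^ (a - 1)
  else t ^ (a + (d % 2).toNat) - t ^ (a - 1)

/-- This is the recursion that `H_H` imposes on the coefficients. It fails for d = 0, where the
coefficient for (2, 1) is t-1 and not t²-1. -/
theorem gapCoeff_succ (d a : ℕ) (hd : 1 ≤ d) :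
    gapCoeff ((d + 2 : ℕ) : ℤ) (a + 1) = t * gapCoeff d a - if a = 0 then 1 else 0 := by
  have hmod : ((d + 2 : ℕ) : ℤ) % 2 = (d : ℤ) % 2 := by omega
  unfold gapCoeff
  rw [if_neg (Nat.succ_ne_zero a), hmod]
  rcases Nat.eq_zero_or_pos a with rfl | ha
  · simp only [if_true]
    split_ifs with h
    · simp [pow_succ]
    -- In this branch ⌊(d+2)/2⌋ = 1, hence d = 1 is odd.
    · have h1 : ((d : ℤ) % 2).toNat = 1 := by omega
      rw [h1]
      simp [pow_succ]
  · obtain ⟨a, rfl⟩ : ∃ c, a = c + 1 := ⟨a - 1, by omega⟩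
    have h : (((a + 1 + 1 : ℕ) : ℤ) < ((d + 2 : ℕ) : ℤ) / 2) ↔ ((a + 1 : ℕ) : ℤ) < (d : ℤ) / 2 := by
      omega
    simp only [h, if_neg (Nat.succ_ne_zero a), Nat.add_sub_cancel]
    split_ifs
    · ring
    · ring

/-- By `H_H`, H_x H_y = t H_y H_x + t H_{x+1} H_{y-1} - H_{y-1} H_{x+1}. The middle product has gap
d-2 and is expanded by induction; the last one corrects the term a = 1. -/
theorem H_H_straighten (f : Sym) (d : ℕ) (hd : 1 ≤ d) (x y : ℤ) (hxy : y - x = d) :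
    H x (H y f) = ∑ a ∈ Finset.range (d / 2 + 1), gapCoeff d a • H (y - a) (H (x + a) f) := by
  induction d using Nat.strong_induction_on generalizing x y with
  | _ d ih =>
    have h := H_H x y f
    match d, hd with
    | 1, _ =>
      have h1 : y - 1 = x := by simp at hxy; omega
      have h2 : x + 1 = y := by omega
      rw [h1, h2] at h
      -- For d = 1 the four terms coincide in pairs, so 2 has to be cancelled.
      have h3 : (2 : Sym) * H x (H y f) = 2 * (T * H y (H x f)) := by linear_combination h
      have h4 := mul_left_cancel₀ two_ne_zero h3
      simp [gapCoeff, t_smul, h4]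
    | 2, _ =>
      have h1 : y - 1 = x + 1 := by push_cast at hxy; omega
      rw [h1] at h
      rw [show 2 / 2 + 1 = 1 + 1 from rfl, Finset.sum_range_succ, Finset.sum_range_one]
      simp only [Nat.cast_zero, Nat.cast_one, sub_zero, add_zero, h1]
      simp [gapCoeff, sub_smul, t_smul]
      linear_combination h
    | d + 3, _ =>
      have ih' := ih (d + 1) (by omega) (by omega) (x + 1) (y - 1) (by push_cast at hxy ⊢; omega)
      have hdiv : (d + 3) / 2 = (d + 1) / 2 + 1 := by omega
      rw [hdiv, Finset.sum_range_succ']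
      have hterm : ∀ a ∈ Finset.range ((d + 1) / 2 + 1),
          gapCoeff ((d + 3 : ℕ) : ℤ) (a + 1) • H (y - (a + 1 : ℕ)) (H (x + (a + 1 : ℕ)) f) =
          t • gapCoeff ((d + 1 : ℕ) : ℤ) a • H (y - 1 - a) (H (x + 1 + a) f) -
            if a = 0 then H (y - 1) (H (x + 1) f) else 0 := by
        intro a _
        rw [gapCoeff_succ (d + 1) a (by omega), sub_smul, smul_smul,
          show y - (a + 1 : ℕ) = y - 1 - a by push_cast; ring,
          show x + (a + 1 : ℕ) = x + 1 + a by push_cast; ring]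
        congr 1
        split_ifs with h0
        · subst h0
          simp
        · simp
      rw [Finset.sum_congr rfl hterm, Finset.sum_sub_distrib, ← Finset.smul_sum, ← ih']
      simp only [t_smul, gapCoeff]
      simp [t_smul]
      linear_combination h

theorem ascent_decomp (α : List ℤ) (i : ℕ) (h : IsAscent α i) :
    ∃ l x y l', α = l ++ x :: y :: l' ∧ x < y ∧ gap α i = y - x ∧
      ∀ a : ℕ, S i a α = l ++ (y - a) :: (x + a) :: l' := by
  induction i generalizing α with
  | zero =>
    obtain ⟨h1, h2⟩ := h
    match α, h1 with
    | x :: y :: l', _ => exact ⟨[], x, y, l', rfl, h2, rfl, fun a => rfl⟩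
  | succ i ih =>
    match α, h with
    | [], h => exact absurd h.1 (by simp)
    | z :: α, h =>
      obtain ⟨l, x, y, l', h1, h2, h3, h4⟩ := ih α ⟨by simpa using h.1, h.2⟩
      refine ⟨z :: l, x, y, l', by rw [h1]; rfl, h2, h3, fun a => ?_⟩
      rw [List.cons_append, ← h4 a]
      rfl

theorem QL_append_sum {ι : Type*} (s : Finset ι) (c : ι → F) (l β : List ℤ) (β' : ι → List ℤ)
    (h : QL β = ∑ a ∈ s, c a • QL (β' a)) :
    QL (l ++ β) = ∑ a ∈ s, c a • QL (l ++ β' a) := by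
  induction l with
  | nil => exact h
  | cons m l ih => simp only [List.cons_append, QL_cons, ih, map_sum, map_smul]

theorem QL_straighten (α : List ℤ) (i : ℕ) (h : IsAscent α i) : QL α =
    ∑ a ∈ Finset.range ((gap α i / 2).toNat + 1), C i a α • QL (S i a α) := by
  obtain ⟨l, x, y, l', h1, h2, h3, h4⟩ := ascent_decomp α i h
  have hC : ∀ a, C i a α = gapCoeff (y - x) a := fun a => by rw [← h3]; rfl
  simp only [hC, h4]
  rw [h3, h1]
  refine QL_append_sum _ _ _ _ _ ?_
  obtain ⟨d, hd⟩ : ∃ d : ℕ, y - x = d := ⟨(y - x).toNat, by omega⟩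
  have := H_H_straighten (QL l') d (by omega) x y hd
  rw [hd, show ((d : ℤ) / 2).toNat = d / 2 by omega]
  exact this

theorem sum_S {α : List ℤ} {i : ℕ} (h : IsAscent α i) (a : ℕ) : (S i a α).sum = α.sum := by
  obtain ⟨l, x, y, l', h1, h2, h3, h4⟩ := ascent_decomp α i h
  rw [h4, h1]
  simp
  ring

/-- A measure that decreases under straightening of sequences with entries at least `L`. -/
def disorder (L : ℤ) : List ℤ → ℕ
  | [] => 0
  | _ :: α => (α.map fun x => (x - L).toNat).sum + disorder L α

theorem disorder_append_lt (L : ℤ) (l β β' : List ℤ) (h : disorder L β' < disorder L β)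
    (hs : (β'.map fun x => (x - L).toNat).sum = (β.map fun x => (x - L).toNat).sum) :
    disorder L (l ++ β') < disorder L (l ++ β) := by
  induction l with
  | nil => exact h
  | cons m l ih =>
    simp only [List.cons_append, disorder, List.map_append, List.sum_append, hs]
    omega

/-- `disorder` weights each excess over L by its position. As x + a < y, the move shifts weight to
the left; entries stay between x and y, so L remains a lower bound. -/
theorem disorder_S_lt {L : ℤ} {α : List ℤ} {i a : ℕ} (h : IsAscent α i) (hL : ∀ x ∈ α, L ≤ x)
    (ha : (a : ℤ) ≤ gap α i / 2) :
    (∀ x ∈ S i a α, L ≤ x) ∧ disorder L (S i a α) < disorder L α := by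
  obtain ⟨l, x, y, l', h1, h2, h3, h4⟩ := ascent_decomp α i h
  rw [h3] at ha
  rw [h4]
  have hx : L ≤ x := hL x (by simp [h1])
  have hy : L ≤ y := hL y (by simp [h1])
  constructor
  · intro z hz
    simp only [List.mem_append, List.mem_cons] at hz
    rcases hz with hz | rfl | rfl | hz
    · exact hL z (by simp [h1, hz])
    · omega
    · omega
    · exact hL z (by simp [h1, hz])
  · rw [h1]
    apply disorder_append_lt
    · simp only [disorder, List.map_cons, List.sum_cons]
      omega
    · simp only [List.map_cons, List.sum_cons]
      omega

theorem not_isAscent_of_pairwise {α : List ℤ} (h : α.Pairwise (· ≥ ·)) (i : ℕ) :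
    ¬ IsAscent α i := by
  intro ha
  obtain ⟨l, x, y, l', h1, h2, -, -⟩ := ascent_decomp α i ha
  rw [h1, List.pairwise_append, List.pairwise_cons] at h
  have := h.2.1.1 y (by simp)
  omega

theorem pairwise_of_not_isAscent {α : List ℤ} (h : ∀ i, ¬ IsAscent α i) :
    α.Pairwise (· ≥ ·) := by
  induction α with
  | nil => exact List.Pairwise.nil
  | cons x α ih =>
    have h1 := ih fun i hi => h (i + 1) ⟨by simpa using hi.1, hi.2⟩
    refine List.pairwise_cons.mpr ⟨fun y hy => ?_, h1⟩
    cases α with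
    | nil => simp at hy
    | cons z α =>
      have h2 : z ≤ x := by
        by_contra hzx
        exact h 0 ⟨by simp, by simpa using hzx⟩
      rcases List.mem_cons.mp hy with rfl | hy'
      · exact h2
      · exact ((List.pairwise_cons.mp h1).1 y hy').trans h2

/-- The last entry k is negative, and H_k · 1 = q_k = 0. -/
theorem QL_eq_zero_of_neg {α : List ℤ} (h : α.Pairwise (· ≥ ·)) (hneg : ∃ x ∈ α, x < 0) :
    QL α = 0 := by
  induction α with
  | nil => simp at hneg
  | cons x α ih =>
    rw [List.pairwise_cons] at h
    obtain ⟨y, hy, hy0⟩ := hneg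
    cases α with
    | nil =>
      simp only [List.mem_singleton] at hy
      rw [QL_cons, QL_nil, H_one, qI_neg (hy ▸ hy0)]
    | cons z α =>
      rw [QL_cons, ih h.2, map_zero]
      rcases List.mem_cons.mp hy with rfl | hy'
      · exact ⟨z, by simp, lt_of_le_of_lt (h.1 z (by simp)) hy0⟩
      · exact ⟨y, hy', hy0⟩

theorem applySeq_append (s : List (ℕ × ℕ)) (i a : ℕ) (α : List ℤ) :
    applySeq (s ++ [(i, a)]) α = applySeq s (S i a α) := by
  induction s with
  | nil => rfl
  | cons p s ih =>
    obtain ⟨j, c⟩ := p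
    simp only [List.cons_append, applySeq, ih]

theorem seqC_append (s : List (ℕ × ℕ)) (i a : ℕ) (α : List ℤ) :
    seqC (s ++ [(i, a)]) α = C i a α * seqC s (S i a α) := by
  induction s with
  | nil => simp [seqC, applySeq]
  | cons p s ih =>
    obtain ⟨j, c⟩ := p
    simp only [List.cons_append, seqC, applySeq_append, ih]
    ring

/-- Moves act from right to left, so splitting off the last pair isolates the first move; this
drives the induction in `straightening`. -/
theorem isStraightening_append (σ : List ℤ → ℕ) (s : List (ℕ × ℕ)) (i a : ℕ) (α : List ℤ) :
    IsStraightening σ (s ++ [(i, a)]) α ↔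
      (IsAscent α i ∧ i = σ α ∧ (a : ℤ) ≤ gap α i / 2) ∧ IsStraightening σ s (S i a α) := by
  induction s with
  | nil => simp [IsStraightening, applySeq]
  | cons p s ih =>
    obtain ⟨j, c⟩ := p
    simp only [List.cons_append, IsStraightening, applySeq_append, ih]
    tauto

theorem straighteningSeqs_of_pairwise (σ : List ℤ → ℕ) (m : ℕ) {α : List ℤ}
    (h : α.Pairwise (· ≥ ·)) : straighteningSeqs σ m α ⊆ {[]} := by
  rintro s ⟨hs, -⟩
  rcases List.eq_nil_or_concat s with rfl | ⟨s', ⟨i, a⟩, rfl⟩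
  · rfl
  · rw [List.concat_eq_append, isStraightening_append] at hs
    exact absurd hs.1.1 (not_isAscent_of_pairwise h i)

theorem straighteningSeqs_of_isAscent {σ : List ℤ → ℕ} (m : ℕ) {α : List ℤ}
    (h : IsAscent α (σ α)) : straighteningSeqs σ m α =
      ⋃ a ∈ (Finset.range ((gap α (σ α) / 2).toNat + 1) : Set ℕ),
        (fun s => s ++ [(σ α, a)]) '' straighteningSeqs σ m (S (σ α) a α) := by
  have hgap : 0 ≤ gap α (σ α) := by
    have := h.2
    simp only [gap]
    omega
  ext s
  simp only [Set.mem_iUnion, Finset.mem_coe, Finset.mem_range, Set.mem_image, exists_prop]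
  constructor
  · rintro ⟨hs, hp⟩
    rcases List.eq_nil_or_concat s with rfl | ⟨s', ⟨i, a⟩, rfl⟩
    · exact absurd h (not_isAscent_of_pairwise hp.1 _)
    · rw [List.concat_eq_append] at hs hp ⊢
      rw [isStraightening_append] at hs
      obtain ⟨⟨-, rfl, ha⟩, hs'⟩ := hs
      rw [applySeq_append] at hp
      exact ⟨a, by omega, s', ⟨hs', hp⟩, rfl⟩
  · rintro ⟨a, ha, s', ⟨hs', hp⟩, rfl⟩
    refine ⟨(isStraightening_append _ _ _ _ _).mpr ⟨⟨h, rfl, by omega⟩, hs'⟩, ?_⟩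
    rwa [applySeq_append]

theorem straightening (σ : List ℤ → ℕ) (hσ : IsRule σ) (m : ℕ) (L : ℤ) (α : List ℤ)
    (hL : ∀ x ∈ α, L ≤ x) (hm : α.sum = m) :
    (straighteningSeqs σ m α).Finite ∧
      QL α = ∑ᶠ s ∈ straighteningSeqs σ m α, seqC s α • QL (applySeq s α) := by
  obtain ⟨N, hN⟩ : ∃ N, disorder L α = N := ⟨_, rfl⟩
  induction N using Nat.strong_induction_on generalizing α with
  | _ N ih =>
    by_cases h : ∃ i, IsAscent α i
    · have hi := hσ α h
      rw [straighteningSeqs_of_isAscent m hi]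
      have hgap : 0 ≤ gap α (σ α) := by
        have := hi.2
        simp only [gap]
        omega
      have ih' : ∀ a ∈ Finset.range ((gap α (σ α) / 2).toNat + 1),
          (straighteningSeqs σ m (S (σ α) a α)).Finite ∧ QL (S (σ α) a α) =
            ∑ᶠ s ∈ straighteningSeqs σ m (S (σ α) a α),
              seqC s (S (σ α) a α) • QL (applySeq s (S (σ α) a α)) := by
        intro a ha
        have ha' := Finset.mem_range.mp ha
        obtain ⟨h1, h2⟩ := disorder_S_lt (a := a) hi hL (by omega)
        exact ih _ (hN ▸ h2) _ h1 ((sum_S hi a).trans hm) rfl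
      refine ⟨(Finset.finite_toSet _).biUnion fun a ha => ((ih' a ha).1).image _, ?_⟩
      rw [finsum_mem_biUnion, finsum_mem_coe_finset, QL_straighten α _ hi]
      · refine Finset.sum_congr rfl fun a ha => ?_
        have hinj : Function.Injective fun s : List (ℕ × ℕ) => s ++ [(σ α, a)] :=
          List.append_left_injective _
        rw [finsum_mem_image hinj.injOn, (ih' a ha).2, smul_finsum_mem (ih' a ha).1]
        refine finsum_mem_congr rfl fun s _ => ?_
        rw [seqC_append, applySeq_append, smul_smul]
      -- The last pair of a sequence records a, so different first moves give disjoint families.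
      · intro a _ c _ hac
        refine Set.disjoint_left.mpr ?_
        rintro _ ⟨s, -, rfl⟩ ⟨s', -, hs'⟩
        have := (List.append_inj' hs' rfl).2
        simp at this
        exact hac this.symm
      · exact Finset.finite_toSet _
      · exact fun a ha => ((ih' a ha).1).image _
    · push Not at h
      have hp := pairwise_of_not_isAscent h
      have hsub := straighteningSeqs_of_pairwise σ m hp
      refine ⟨(Set.finite_singleton _).subset hsub, ?_⟩
      by_cases hpos : ∀ x ∈ α, 0 ≤ x
      · have heq : straighteningSeqs σ m α = {[]} :=
          hsub.antisymm (Set.singleton_subset_iff.mpr ⟨trivial, hp, hpos, hm⟩)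
        rw [heq, finsum_mem_singleton]
        simp [seqC, applySeq]
      · have heq : straighteningSeqs σ m α = ∅ := by
          refine Set.eq_empty_of_forall_notMem fun s hs => hpos ?_
          have := hsub hs
          rw [Set.mem_singleton_iff] at this
          subst this
          exact hs.2.2.1
        rw [heq, finsum_mem_empty]
        push Not at hpos
        exact QL_eq_zero_of_neg hp hpos

/-! ### The recursion -/

/-- Trailing zeros are harmless because H_0 · 1 = q_0 = 1. -/
theorem QL_filter_pos {α : List ℤ} (h : α.Pairwise (· ≥ ·)) (h0 : ∀ x ∈ α, 0 ≤ x) :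
    QL (α.filter (0 < ·)) = QL α := by
  induction α with
  | nil => rfl
  | cons x α ih =>
    rw [List.pairwise_cons] at h
    have ih' := ih h.2 fun y hy => h0 y (List.mem_cons_of_mem _ hy)
    by_cases hx : 0 < x
    · rw [List.filter_cons_of_pos (by simpa using hx), QL_cons, QL_cons, ih']
    · have hx0 : x = 0 := le_antisymm (not_lt.mp hx) (h0 x (by simp))
      subst hx0
      have hf : α.filter (0 < ·) = [] := by
        rw [List.filter_eq_nil_iff]
        intro y hy
        simpa using h.1 y hy
      rw [hf] at ih'
      rw [List.filter_cons_of_neg (by simp), hf, QL_cons, ← ih', QL_nil, H_one, qI_zero]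

theorem rowsZ_ofSums {m : ℕ} {α : List ℤ} (hα : IsPart m α)
    (h : (Multiset.ofList (α.map Int.toNat)).sum = m) :
    rowsZ (Nat.Partition.ofSums m (Multiset.ofList (α.map Int.toNat)) h) =
      α.filter (0 < ·) := by
  obtain ⟨hp, h0, -⟩ := hα
  refine List.Perm.eq_of_pairwise (le := (· ≥ ·)) (fun a b _ _ h1 h2 => le_antisymm h2 h1)
    (rowsZ_pairwise _) (hp.sublist List.filter_sublist) ?_
  rw [← Multiset.coe_eq_coe, rowsZ, ← Multiset.map_coe, coe_rows]
  simp only [Nat.Partition.ofSums, Multiset.filter_coe, Multiset.map_coe, Multiset.coe_eq_coe]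
  rw [List.filter_map, List.map_map]
  have h1 : α.filter ((fun x => decide (x ≠ 0)) ∘ Int.toNat) = α.filter (0 < ·) := by
    refine List.filter_congr fun x hx => ?_
    simp only [Function.comp_apply, decide_eq_decide]
    have := h0 x hx
    omega
  have h2 : (α.filter (0 < ·)).map ((Nat.cast : ℕ → ℤ) ∘ Int.toNat) = α.filter (0 < ·) := by
    conv_rhs => rw [← List.map_id (α.filter (0 < ·))]
    refine List.map_congr_left fun x hx => ?_
    have := h0 x (List.mem_of_mem_filter hx)
    simp [this]
  rw [h1, h2]

theorem greenSeq_eq {m : ℕ} {α : List ℤ} (hα : IsPart m α) (nu : m.Partition) :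
    greenSeq α nu = form (powS nu) (QL α) := by
  have h : (Multiset.ofList (α.map Int.toNat)).sum = m := by
    have h1 : ((α.map Int.toNat).sum : ℤ) = α.sum := by
      rw [Nat.cast_list_sum, List.map_map]
      congr 1
      conv_rhs => rw [← List.map_id α]
      refine List.map_congr_left fun x hx => ?_
      have := hα.2.1 x hx
      simp [this]
    rw [hα.2.2] at h1
    rw [Multiset.sum_coe]
    exact_mod_cast h1
  rw [greenSeq, dif_pos h, green_eq, rowsZ_ofSums hα, QL_filter_pos hα.1 hα.2.1]

theorem subAt_eq {n : ℕ} (lam : n.Partition) (k j : ℕ) :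
    subAt lam k j = (rowsZ lam).modify j fun x => x - k := by
  -- In `subAt` the cast acts on the whole list through the list monad and the mapped function is
  -- the identity of ℤ.
  rw [subAt, rowsZ, List.map_id']
  congr 1
  exact List.flatMap_pure_eq_map _ _

theorem firstPart_mem {n : ℕ} (hn : 1 ≤ n) (mu : n.Partition) : firstPart mu ∈ mu.parts := by
  rw [← mem_rows, firstPart]
  cases h : rows mu with
  | nil =>
    have h1 := mu.parts_sum
    rw [← coe_rows, h] at h1
    simp at h1
    omega
  | cons a l => simp

theorem powS_eq_mul {n : ℕ} (hn : 1 ≤ n) (mu : n.Partition) :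
    powS mu = MvPolynomial.X (firstPart mu - 1) * powS (tail mu) := by
  rw [powS, ← Multiset.cons_erase (firstPart_mem hn mu), Multiset.map_cons, Multiset.prod_cons]
  rfl

theorem sum_modify_sub (α : List ℤ) (k : ℤ) (j : ℕ) (hj : j < α.length) :
    (α.modify j fun x => x - k).sum = α.sum - k := by
  induction α generalizing j with
  | nil => simp at hj
  | cons x α ih =>
    cases j with
    | zero => simp; ring
    | succ j =>
      rw [List.modify_succ_cons, List.sum_cons, ih j (by simpa using hj), List.sum_cons]
      ring

theorem exists_lower_bound (α : List ℤ) : ∃ L, ∀ x ∈ α, L ≤ x := by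
  induction α with
  | nil => exact ⟨0, by simp⟩
  | cons a α ih =>
    obtain ⟨L, hL⟩ := ih
    refine ⟨min a L, fun x hx => ?_⟩
    rcases List.mem_cons.mp hx with rfl | hx
    · exact min_le_left _ _
    · exact (min_le_right _ _).trans (hL x hx)

theorem rowsZ_length {n : ℕ} (lam : n.Partition) : (rowsZ lam).length = lam.parts.card := by
  rw [rowsZ, List.length_map, ← coe_rows, Multiset.coe_card]

theorem straightening_subAt {n : ℕ} (lam : n.Partition) {k : ℕ} (hk : k ≤ n) {σ : List ℤ → ℕ}
    (hσ : IsRule σ) {j : ℕ} (hj : j < lam.parts.card) :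
    (straighteningSeqs σ (n - k) (subAt lam k j)).Finite ∧
      QL (subAt lam k j) = ∑ᶠ s ∈ straighteningSeqs σ (n - k) (subAt lam k j),
        seqC s (subAt lam k j) • QL (applySeq s (subAt lam k j)) := by
  obtain ⟨L, hL⟩ := exists_lower_bound (subAt lam k j)
  refine straightening σ hσ (n - k) L _ hL ?_
  rw [subAt_eq, sum_modify_sub _ _ _ (by rwa [rowsZ_length]), rowsZ_sum, Nat.cast_sub hk]

theorem firstPart_le {n : ℕ} (mu : n.Partition) : firstPart mu ≤ n := by
  have := firstPart_add_sum mu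
  omega

end GreenMN

end

/-! ### The recursion for Green polynomials -/

theorem mainTheorem4 (n : ℕ) (hn : 1 ≤ n) (lam mu : n.Partition)
    (σ : List ℤ → ℕ) (hσ : GreenMN.IsRule σ) :
    (∀ (m : ℕ) (nu : m.Partition), ∃! c : m.Partition → GreenMN.F, GreenMN.IsExpansion nu c) ∧
    (∀ j < lam.parts.card,
      (GreenMN.straighteningSeqs σ (n - GreenMN.firstPart mu)
        (GreenMN.subAt lam (GreenMN.firstPart mu) j)).Finite) ∧
    GreenMN.green lam mu =
      ∑ j ∈ Finset.range lam.parts.card,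
        ∑ᶠ s ∈ GreenMN.straighteningSeqs σ (n - GreenMN.firstPart mu)
            (GreenMN.subAt lam (GreenMN.firstPart mu) j),
          GreenMN.seqC s (GreenMN.subAt lam (GreenMN.firstPart mu) j) *
            GreenMN.greenSeq (GreenMN.applySeq s (GreenMN.subAt lam (GreenMN.firstPart mu) j))
              (GreenMN.tail mu) := by
  have hst := fun j hj => GreenMN.straightening_subAt (j := j) lam (GreenMN.firstPart_le mu) hσ hj
  refine ⟨fun m nu => ⟨_, GreenMN.isExpansion_form nu, fun c hc =>
    GreenMN.isExpansion_unique nu c hc⟩, fun j hj => (hst j hj).1, ?_⟩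
  have hpos : 0 < GreenMN.firstPart mu := mu.parts_pos (GreenMN.firstPart_mem hn mu)
  -- The variable of index μ₁ - 1 stands for p_{μ₁}; positivity of μ₁ makes the truncated
  -- subtraction exact.
  have hk : ((GreenMN.firstPart mu - 1 : ℕ) : ℤ) + 1 = GreenMN.firstPart mu := by omega
  rw [GreenMN.green_eq, GreenMN.powS_eq_mul hn, GreenMN.form_X_mul, GreenMN.pp_QL, map_sum,
    GreenMN.rowsZ_length]
  refine Finset.sum_congr rfl fun j hj => ?_
  obtain ⟨hfin, hQ⟩ := hst j (Finset.mem_range.mp hj)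
  rw [hk, ← GreenMN.subAt_eq, hQ]
  refine ((GreenMN.form (GreenMN.powS (GreenMN.tail mu))).toAddMonoidHom.map_finsum_mem _
    hfin).trans ?_
  refine finsum_mem_congr rfl fun s hs => ?_
  rw [LinearMap.toAddMonoidHom_coe, map_smul, GreenMN.greenSeq_eq hs.2, smul_eq_mul]
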